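/- Let $\lambda$ be Lebesgue measure on $[0,1]$ and let $C(\lambda)$ be the space of continuous maps $f:[0,1]\to[0,1]$ that preserve $\lambda$, with the topology of uniform convergence. For $f\in C(\lambda)$ let $\mu_f$ be the permuton (probability measure on $[0,1]^2$ with uniform marginals) given by $\mu_f(A\times B)=\lambda(A\cap f^{-1}(B))$. Let $H_n(\mu_f)$ be the Shannon entropy, with natural logarithm, of the random permutation of $\{1,\dots,n\}$ obtained by drawing $n$ independent points from $\mu_f$ and reading their height ordering from left to right. Then for the generic $f\in C(\lambda)$, that is, for all $f$ in a residual (comeager) subset of $C(\lambda)$, $$\liminf_{n\to\infty}\frac{H_n(\mu_f)}{n}=0\qquad\text{and}\qquad\limsup_{n\to\infty}\frac{H_n(\mu_f)}{n\log n}=1.$$ Consequently, for such $f$, neither $H_n(\mu_f)/n$ nor $H_n(\mu_f)/(n\log n)$ has a limit in $[-\infty,+\infty]$ as $n\to\infty$. -/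

import Mathlib

open MeasureTheory Filter Topology

/-- A permuton: a probability measure on the unit square with uniform marginals. -/
structure Permuton where
  /-- the underlying measure on the unit square -/
  toMeasure : Measure (unitInterval × unitInterval)
  /-- it is a probability measure -/
  isProb : IsProbabilityMeasure toMeasure
  /-- the first marginal is Lebesgue measure -/
  map_fst : toMeasure.map Prod.fst = volume
  /-- the second marginal is Lebesgue measure -/
  map_snd : toMeasure.map Prod.snd = volume

/-- The space `C(λ)` of continuous maps of `[0,1]` to itself that preserve Lebesgue measure, with
the topology of uniform convergence (the subspace topology of the compact-open topology). -/
abbrev CLambda : Type := {f : C(unitInterval, unitInterval) // MeasurePreserving f volume volume}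

/-- The permuton `μ_f` carried by the graph of a measure-preserving map `f`, that is, the
distribution of `(x, f x)` for `x` uniform in `[0,1]`. -/
noncomputable def graphPermuton (f : unitInterval → unitInterval) (hf : MeasurePreserving f volume volume) :
    Permuton where
  toMeasure := (volume : Measure unitInterval).map fun x => (x, f x)
  isProb := Measure.isProbabilityMeasure_map (measurable_id'.prodMk hf.measurable).aemeasurable
  map_fst := by
    rw [Measure.map_map measurable_fst (measurable_id'.prodMk hf.measurable)]
    exact Measure.map_id
  map_snd := by
    rw [Measure.map_map measurable_snd (measurable_id'.prodMk hf.measurable)]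
    exact hf.map_eq

/-- The points `p 0, …, p (n-1)` of the square have pairwise distinct abscissas and pairwise distinct
ordinates, and when they are listed from left to right (by `τ`), their heights are ordered as the
values of `σ`. -/
def HasPattern {n : ℕ} (p : Fin n → unitInterval × unitInterval) (σ : Equiv.Perm (Fin n)) : Prop :=
  ∃ τ : Equiv.Perm (Fin n), StrictMono (fun i => (p (τ i)).1) ∧
    ∀ i j, σ i < σ j ↔ (p (τ i)).2 < (p (τ j)).2

namespace Permuton

/-- The pattern density `t(σ, μ)`: the probability that `n` independent points of law `μ` form the
pattern `σ`. -/
noncomputable def density (μ : Permuton) {n : ℕ} (σ : Equiv.Perm (Fin n)) : ℝ :=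
  (Measure.pi fun _ : Fin n => μ.toMeasure).real {p | HasPattern p σ}

/-- The sampling entropy `H_n(μ)`: the Shannon entropy (natural logarithm) of the random pattern of
`n` independent points of law `μ`. -/
noncomputable def samplingEntropy (μ : Permuton) (n : ℕ) : ℝ :=
  ∑ σ : Equiv.Perm (Fin n), Real.negMulLog (μ.density σ)

end Permuton

/-- The sampling entropy `H_n(μ_f)` of the graph permuton of `f ∈ C(λ)`. -/
noncomputable def graphEntropy (f : CLambda) (n : ℕ) : ℝ :=
  (graphPermuton f.1 f.2).samplingEntropy n

/-! ### Patterns -/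

/-! The argument is by Baire category. For fixed `n` the map `f ↦ H_n(μ_f)` is continuous on `C(λ)`:
almost every sample has distinct heights under `f`, and its pattern is then unchanged under a small
uniform perturbation of `f` (`continuous_density`). Hence `H_n < ε n` and `H_n > (1 - ε) n log n`
are open conditions. It remains to show that each of them holds for arbitrarily large `n` on a dense
set; countable intersections over `N` and `ε` then give the residual set. The universal bounds `0 ≤
H_n ≤ log n! ≤ n log n` turn these frequent inequalities into the exact values of the liminf and
limsup.

High entropy (`exists_graphEntropy_gt`): precompose `f` with a comb close to the identity that
traverses each of `m` equal blocks `k` times. For `k` large, `n` samples usually lie on distinct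
monotone pieces. The pieces then fix the left-to-right order, while the heights are free: their
joint law on a given choice of pieces is at most `k⁻¹ ^ n` times Lebesgue measure, and each order of
the heights has Lebesgue measure at most `1 / n!`. Summing over the choices of pieces, every pattern
has probability at most about `m ^ n / n!`, so `H_n ≥ log n! - n log m - log 2`. Since `m` depends
only on `f` and the accuracy, the loss is negligible against `n log n`.

Low entropy (`exists_graphEntropy_lt`): Hall's marriage theorem yields a permutation of `N + 1`
equal blocks that approximates `f`. It is made continuous by very fast transits between successive
blocks. Samples that avoid the transits have a pattern determined by the number of points in each
block, so at most `(n + 1) ^ (N + 1)` patterns occur and `H_n` is of order `log n`. The transit time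
is chosen after `n`, so that the exceptional samples contribute at most `1`. -/

theorem sortingPerm_unique {n : ℕ} {α : Type*} [LinearOrder α] {a : Fin n → α}
    {τ τ' : Equiv.Perm (Fin n)} (h : StrictMono (a ∘ τ)) (h' : StrictMono (a ∘ τ')) : τ = τ' := by
  have ha : Function.Injective a := by
    have := h.injective.comp τ.symm.injective
    rwa [Function.comp_assoc, Equiv.self_comp_symm, Function.comp_id] at this
  have := Tuple.unique_monotone h.monotone h'.monotone
  exact Equiv.ext fun i => ha (congrFun this i)

theorem perm_eq_of_lt_iff {n : ℕ} {σ σ' : Equiv.Perm (Fin n)}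
    (h : ∀ i j, σ i < σ j ↔ σ' i < σ' j) : σ = σ' := by
  have h1 : StrictMono (σ' ∘ σ.symm) := fun i j hij => (h _ _).1 (by simpa using hij)
  have h2 : StrictMono (σ' ∘ σ'.symm) := fun i j hij => by simpa using hij
  exact Equiv.symm_bijective.injective (sortingPerm_unique h1 h2)

theorem HasPattern.unique {n : ℕ} {p : Fin n → unitInterval × unitInterval}
    {σ σ' : Equiv.Perm (Fin n)} (h : HasPattern p σ) (h' : HasPattern p σ') : σ = σ' := by
  obtain ⟨τ, hτ, hσ⟩ := h
  obtain ⟨τ', hτ', hσ'⟩ := h'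
  obtain rfl : τ = τ' := sortingPerm_unique (a := fun i => (p i).1) hτ hτ'
  exact perm_eq_of_lt_iff fun i j => (hσ i j).trans (hσ' i j).symm

theorem Function.Injective.strictMono_comp_sort {n : ℕ} {α : Type*} [LinearOrder α]
    {a : Fin n → α} (ha : Function.Injective a) : StrictMono (a ∘ Tuple.sort a) :=
  (Tuple.monotone_sort a).strictMono_of_injective (ha.comp (Tuple.sort a).injective)

theorem exists_hasPattern {n : ℕ} {p : Fin n → unitInterval × unitInterval}
    (h1 : Function.Injective fun i => (p i).1) (h2 : Function.Injective fun i => (p i).2) :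
    ∃ σ, HasPattern p σ := by
  set τ := Tuple.sort fun i => (p i).1
  have hb : Function.Injective fun i => (p (τ i)).2 := h2.comp τ.injective
  have hs := hb.strictMono_comp_sort
  refine ⟨(Tuple.sort fun i => (p (τ i)).2).symm, τ, h1.strictMono_comp_sort, fun i j => ?_⟩
  rw [← hs.lt_iff_lt]
  simp

theorem measurableSet_strictMono {n : ℕ} (τ : Fin n → Fin n) :
    MeasurableSet {x : Fin n → unitInterval | StrictMono fun i => x (τ i)} := by
  simp only [StrictMono, Set.ofPred_forall]
  exact .iInter fun i => .iInter fun j => .iInter fun _ =>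
    measurableSet_lt (measurable_pi_apply _) (measurable_pi_apply _)

theorem measurableSet_hasPattern {n : ℕ} (σ : Equiv.Perm (Fin n)) :
    MeasurableSet {p : Fin n → unitInterval × unitInterval | HasPattern p σ} := by
  simp only [HasPattern, Set.ofPred_exists, Set.ofPred_and, Set.ofPred_forall]
  refine .iUnion fun τ => .inter ?_ (.iInter fun i => .iInter fun j => ?_)
  · exact measurableSet_strictMono (n := n) τ |>.preimage
      (f := fun (p : Fin n → unitInterval × unitInterval) i => (p i).1) (by fun_prop)
  · have : MeasurableSet {p : Fin n → unitInterval × unitInterval |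
        (p (τ i)).2 < (p (τ j)).2} := measurableSet_lt (by fun_prop) (by fun_prop)
    by_cases h : σ i < σ j <;> simp only [h, true_iff, false_iff]
    exacts [this, this.compl]

/-- The event that `n` points on the graph of `f`, with abscissas `x`, form the pattern `σ`. -/
def patternEvent (f : unitInterval → unitInterval) {n : ℕ} (σ : Equiv.Perm (Fin n)) :
    Set (Fin n → unitInterval) :=
  {x | HasPattern (fun i => (x i, f (x i))) σ}

theorem mem_patternEvent {f : unitInterval → unitInterval} {n : ℕ} {σ : Equiv.Perm (Fin n)}
    {x : Fin n → unitInterval} :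
    x ∈ patternEvent f σ ↔ HasPattern (fun i => (x i, f (x i))) σ :=
  Iff.rfl

theorem measurableSet_patternEvent {f : unitInterval → unitInterval} (hf : Measurable f) {n : ℕ}
    (σ : Equiv.Perm (Fin n)) : MeasurableSet (patternEvent f σ) :=
  (measurableSet_hasPattern σ).preimage
    (f := fun (x : Fin n → unitInterval) i => (x i, f (x i))) (by fun_prop)

theorem density_graphPermuton {f : unitInterval → unitInterval} (hf : MeasurePreserving f volume volume)
    {n : ℕ} (σ : Equiv.Perm (Fin n)) :
    (graphPermuton f hf).density σ =
      (volume : Measure (Fin n → unitInterval)).real (patternEvent f σ) := by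
  have hm := hf.measurable
  have key : Measure.pi (fun _ : Fin n => (graphPermuton f hf).toMeasure) =
      (volume : Measure (Fin n → unitInterval)).map fun x i => (x i, f (x i)) := by
    have := (graphPermuton f hf).isProb
    rw [volume_pi]
    exact (Measure.pi_map_pi (μ := fun _ : Fin n => (volume : Measure unitInterval))
      (f := fun _ x => (x, f x)) (fun _ => by fun_prop)).symm
  rw [Permuton.density, key, map_measureReal_apply (by fun_prop) (measurableSet_hasPattern σ)]
  rfl

theorem ae_injective (n : ℕ) :
    ∀ᵐ x : Fin n → unitInterval, Function.Injective x := by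
  have : ∀ i j : Fin n, i ≠ j → ∀ᵐ x : Fin n → unitInterval, x i ≠ x j := by
    intro i j hij
    have hi := (ProbabilityTheory.iIndepFun_pi
      (μ := fun _ : Fin n => (volume : Measure unitInterval)) (X := fun _ x => x)
      (fun _ => aemeasurable_id)).indepFun hij
    rw [ProbabilityTheory.indepFun_iff_map_prod_eq_prod_map_map
      (measurable_pi_apply i).aemeasurable (measurable_pi_apply j).aemeasurable] at hi
    have e : ∀ k : Fin n, (Measure.pi fun _ : Fin n => (volume : Measure unitInterval)).map
        (fun x => x k) = volume := fun k => (measurePreserving_eval _ k).map_eq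
    rw [e, e] at hi
    have hd : ((volume : Measure unitInterval).prod volume) {z | z.1 = z.2} = 0 := by
      rw [Measure.measure_prod_null (measurableSet_eq_fun measurable_fst measurable_snd)]
      refine Eventually.of_forall fun y => ?_
      have : Prod.mk y ⁻¹' {z : unitInterval × unitInterval | z.1 = z.2} = {y} := by
        ext z; simp [eq_comm]
      simp [this]
    rw [← hi, Measure.map_apply (by fun_prop)
      (measurableSet_eq_fun measurable_fst measurable_snd)] at hd
    rw [ae_iff, volume_pi]
    simpa using hd
  filter_upwards [ae_all_iff.2 fun i => ae_all_iff.2 fun j => ae_all_iff.2 (this i j)] with x hx i j h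
  by_contra hne
  exact hx i j hne h

theorem measurePreserving_comp_pi {f : unitInterval → unitInterval}
    (hf : MeasurePreserving f volume volume) (n : ℕ) :
    MeasurePreserving (fun (x : Fin n → unitInterval) i => f (x i)) volume volume :=
  volume_preserving_pi fun _ => hf

theorem ae_injective_comp {f : unitInterval → unitInterval}
    (hf : MeasurePreserving f volume volume) (n : ℕ) :
    ∀ᵐ x : Fin n → unitInterval, Function.Injective fun i => f (x i) :=
  (measurePreserving_comp_pi hf n).quasiMeasurePreserving.ae (ae_injective n)

theorem sum_measureReal_le_of_disjoint_cover {α ι : Type*} [MeasurableSpace α] (μ : Measure α)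
    [IsFiniteMeasure μ] (s : Finset ι) (A : ι → Set α) (hA : ∀ i, MeasurableSet (A i))
    (hd : Pairwise (Function.onFun Disjoint A)) {B : Set α} (h : ∀ i ∈ s, A i ⊆ B) :
    ∑ i ∈ s, μ.real (A i) ≤ μ.real B := by
  rw [← measureReal_biUnion_finset (fun i _ j _ h => hd h) (fun i _ => hA i)]
  exact measureReal_mono (Set.iUnion₂_subset h)

theorem disjoint_patternEvent (f : unitInterval → unitInterval) (n : ℕ) :
    Pairwise (Function.onFun Disjoint fun σ : Equiv.Perm (Fin n) => patternEvent f σ) :=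
  fun _ _ hne => Set.disjoint_left.2 fun _ h h' =>
    hne ((mem_patternEvent.1 h).unique (mem_patternEvent.1 h'))

theorem sum_density {f : unitInterval → unitInterval} (hf : MeasurePreserving f volume volume)
    (n : ℕ) : ∑ σ : Equiv.Perm (Fin n), (graphPermuton f hf).density σ = 1 := by
  simp only [density_graphPermuton hf]
  rw [← measureReal_biUnion_finset (fun i _ j _ h => disjoint_patternEvent f n h)
    (fun σ _ => measurableSet_patternEvent hf.measurable σ)]
  rw [measureReal_def, (mem_ae_iff_prob_eq_one (Finset.measurableSet_biUnion _
    fun σ _ => measurableSet_patternEvent hf.measurable σ)).1, ENNReal.toReal_one]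
  filter_upwards [ae_injective n, ae_injective_comp hf n] with x h1 h2
  simpa [mem_patternEvent] using exists_hasPattern (p := fun i => (x i, f (x i))) h1 h2

theorem density_nonneg (μ : Permuton) {n : ℕ} (σ : Equiv.Perm (Fin n)) : 0 ≤ μ.density σ :=
  measureReal_nonneg

theorem density_le_one (μ : Permuton) {n : ℕ} (σ : Equiv.Perm (Fin n)) : μ.density σ ≤ 1 := by
  have := μ.isProb
  exact measureReal_le_one

/-! ### Continuity of the sampling entropy -/

theorem continuous_density {n : ℕ} (σ : Equiv.Perm (Fin n)) :
    Continuous fun f : CLambda => (graphPermuton f.1 f.2).density σ := by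
  simp only [density_graphPermuton]
  rw [continuous_iff_continuousAt]
  intro f
  have key : Tendsto (fun g : CLambda => (volume : Measure (Fin n → unitInterval))
      (patternEvent g.1 σ)) (𝓝 f) (𝓝 (volume (patternEvent f.1 σ))) := by
    refine tendsto_measure_of_ae_tendsto_indicator_of_isFiniteMeasure (𝓝 f)
      (measurableSet_patternEvent f.2.measurable σ)
      (fun g => measurableSet_patternEvent g.2.measurable σ) ?_
    -- Where the values of `f` are distinct, the finitely many strict comparisons persist for `g`
    -- near `f`, so the indicators are eventually constant.
    filter_upwards [ae_injective_comp f.2 n] with x hx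
    have hc : ∀ i, Tendsto (fun g : CLambda => g.1 (x i)) (𝓝 f) (𝓝 (f.1 (x i))) := fun i =>
      ((continuous_eval_const (x i)).comp continuous_subtype_val).continuousAt
    have hev : ∀ i j, ∀ᶠ g : CLambda in 𝓝 f,
        (g.1 (x i) < g.1 (x j) ↔ f.1 (x i) < f.1 (x j)) := by
      intro i j
      rcases lt_trichotomy (f.1 (x i)) (f.1 (x j)) with h | h | h
      · filter_upwards [(hc i).eventually_lt (hc j) h] with g hg
        simp [h, hg]
      · obtain rfl : i = j := hx h
        simp
      · filter_upwards [(hc j).eventually_lt (hc i) h] with g hg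
        exact iff_of_false hg.not_gt h.not_gt
    filter_upwards [eventually_all.2 fun i => eventually_all.2 (hev i)] with g hg
    simp only [mem_patternEvent, HasPattern, hg]
  exact (ENNReal.tendsto_toReal (measure_ne_top _ _)).comp key

theorem continuous_graphEntropy (n : ℕ) : Continuous fun f : CLambda => graphEntropy f n :=
  continuous_finsetSum _ fun σ _ => Real.continuous_negMulLog.comp (continuous_density σ)

/-! ### Entropy estimates -/

/-- This is `log u ≤ u - 1` at `u = 1 / (p a)`, multiplied by `p`: the tangent to `negMulLog` at `1
/ a`. -/
theorem negMulLog_le_mul_log_add {p a : ℝ} (hp : 0 ≤ p) (ha : 0 < a) :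
    Real.negMulLog p ≤ p * Real.log a + 1 / a - p := by
  rcases hp.eq_or_lt with rfl | hp
  · simp [ha.le]
  have := Real.log_le_sub_one_of_pos (x := 1 / (p * a)) (by positivity)
  rw [Real.log_div one_ne_zero (by positivity), Real.log_one, Real.log_mul hp.ne' ha.ne'] at this
  have h2 : p * (1 / (p * a)) = 1 / a := by field_simp
  have := mul_le_mul_of_nonneg_left this hp.le
  rw [Real.negMulLog]
  nlinarith

/-- The masses need not sum to `1`. Keeping the total mass as a factor makes an unlikely family of
patterns cost only its probability times the logarithm of its size. -/
theorem sum_negMulLog_le {ι : Type*} (s : Finset ι) {p : ι → ℝ} (hp : ∀ i ∈ s, 0 ≤ p i) {a : ℝ}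
    (ha : 0 < a) (hs : (s.card : ℝ) ≤ a) :
    ∑ i ∈ s, Real.negMulLog (p i) ≤ (∑ i ∈ s, p i) * Real.log a + 1 := by
  have h1 : ∑ i ∈ s, Real.negMulLog (p i) ≤ ∑ i ∈ s, (p i * Real.log a + 1 / a) :=
    Finset.sum_le_sum fun i hi => by
      linarith [negMulLog_le_mul_log_add (hp i hi) ha, hp i hi]
  rw [Finset.sum_add_distrib, ← Finset.sum_mul, Finset.sum_const, nsmul_eq_mul] at h1
  have : (s.card : ℝ) * (1 / a) ≤ 1 := by
    rw [mul_one_div]; exact (div_le_one ha).2 hs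
  linarith

theorem graphEntropy_nonneg (f : CLambda) (n : ℕ) : 0 ≤ graphEntropy f n :=
  Finset.sum_nonneg fun σ _ => Real.negMulLog_nonneg (density_nonneg _ σ) (density_le_one _ σ)

theorem graphEntropy_le_of_concentrated (f : CLambda) {n : ℕ} (S : Finset (Equiv.Perm (Fin n)))
    {a q : ℝ} (ha : 1 ≤ a) (hS : (S.card : ℝ) ≤ a)
    (hq : ∑ σ ∈ Sᶜ, (graphPermuton f.1 f.2).density σ ≤ q) :
    graphEntropy f n ≤ Real.log a + q * Real.log (n.factorial) + 2 := by
  have hfac : (1 : ℝ) ≤ n.factorial := by exact_mod_cast n.factorial_pos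
  have h1 := sum_negMulLog_le S (p := (graphPermuton f.1 f.2).density)
    (fun σ _ => density_nonneg _ σ) (by linarith) hS
  have h2 := sum_negMulLog_le Sᶜ (p := (graphPermuton f.1 f.2).density)
    (fun σ _ => density_nonneg _ σ) (a := n.factorial) (by linarith) (by
      have := Finset.card_le_univ Sᶜ
      rw [Fintype.card_perm, Fintype.card_fin] at this
      exact_mod_cast this)
  have h3 := Finset.sum_add_sum_compl S (graphPermuton f.1 f.2).density
  rw [sum_density] at h3
  have h4 : 0 ≤ ∑ σ ∈ Sᶜ, (graphPermuton f.1 f.2).density σ :=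
    Finset.sum_nonneg fun σ _ => density_nonneg _ σ
  have h5 := mul_le_of_le_one_left (Real.log_nonneg ha)
    (show ∑ σ ∈ S, (graphPermuton f.1 f.2).density σ ≤ 1 by linarith)
  have h6 := mul_le_mul_of_nonneg_right hq (Real.log_nonneg hfac)
  rw [graphEntropy, Permuton.samplingEntropy, ← Finset.sum_add_sum_compl S]
  linarith

theorem graphEntropy_le_log_factorial (f : CLambda) (n : ℕ) :
    graphEntropy f n ≤ Real.log (n.factorial) := by
  have hfac : (1 : ℝ) ≤ n.factorial := by exact_mod_cast n.factorial_pos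
  have h1 : graphEntropy f n ≤ ∑ σ, ((graphPermuton f.1 f.2).density σ * Real.log (n.factorial) +
      1 / (n.factorial) - (graphPermuton f.1 f.2).density σ) :=
    Finset.sum_le_sum fun σ _ => negMulLog_le_mul_log_add (density_nonneg _ σ) (by linarith)
  rw [Finset.sum_sub_distrib, Finset.sum_add_distrib, ← Finset.sum_mul, sum_density,
    Finset.sum_const, Finset.card_univ, Fintype.card_perm, Fintype.card_fin, nsmul_eq_mul,
    mul_one_div_cancel (by linarith)] at h1
  linarith

theorem le_graphEntropy_of_density_le (f : CLambda) {n : ℕ} {B : ℝ}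
    (h : ∀ σ : Equiv.Perm (Fin n), (graphPermuton f.1 f.2).density σ ≤ B) :
    -Real.log B ≤ graphEntropy f n := by
  have : ∑ σ : Equiv.Perm (Fin n), (graphPermuton f.1 f.2).density σ * (-Real.log B) ≤
      graphEntropy f n := by
    refine Finset.sum_le_sum fun σ _ => ?_
    rcases (density_nonneg (graphPermuton f.1 f.2) σ).eq_or_lt with h0 | h0
    · simp [← h0]
    · have := mul_le_mul_of_nonneg_left (Real.log_le_log h0 (h σ)) h0.le
      rw [Real.negMulLog]
      linarith
  rwa [← Finset.sum_mul, sum_density, one_mul] at this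

/-! ### Piecewise linear measure-preserving maps -/

/-- The data of a continuous piecewise linear path in `[0,1]` with `L` pieces: the `k`-th piece runs
from `a k` to `a (k+1)` and spends time `c k` per unit of length. The occupation density of the
path is `1` on `(0,1]`. -/
structure Zigzag where
  /-- number of pieces -/
  L : ℕ
  /-- the turning points -/
  a : ℕ → ℝ
  /-- the inverse speeds -/
  c : ℕ → ℝ
  mem : ∀ k, k ≤ L → a k ∈ Set.Icc (0 : ℝ) 1
  c_pos : ∀ k, k < L → 0 < c k
  -- Half-open ranges make abutting pieces disjoint, so the sum is exactly `1` even at turning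
  -- points.
  cover : ∀ y ∈ Set.Ioc (0 : ℝ) 1,
    ∑ k ∈ Finset.range L, (Set.uIoc (a k) (a (k + 1))).indicator (fun _ => c k) y = 1

namespace Zigzag

variable (Z : Zigzag)

/-- The time at which the `k`-th piece starts. -/
noncomputable def t (k : ℕ) : ℝ := ∑ l ∈ Finset.range k, Z.c l * |Z.a (l + 1) - Z.a l|

theorem t_zero : Z.t 0 = 0 := by simp [t]

theorem t_succ (k : ℕ) : Z.t (k + 1) = Z.t k + Z.c k * |Z.a (k + 1) - Z.a k| := by
  simp [t, Finset.sum_range_succ]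

theorem t_le_succ {k : ℕ} (hk : k < Z.L) : Z.t k ≤ Z.t (k + 1) := by
  rw [t_succ]
  have := mul_nonneg (Z.c_pos k hk).le (abs_nonneg (Z.a (k + 1) - Z.a k))
  linarith

theorem t_mono {k l : ℕ} (hkl : k ≤ l) (hl : l ≤ Z.L) : Z.t k ≤ Z.t l := by
  induction l, hkl using Nat.le_induction with
  | base => exact le_rfl
  | succ l _ ih => exact (ih (by omega)).trans (Z.t_le_succ (by omega))

/-- The path, as a function on the line. -/
noncomputable def toFun (x : ℝ) : ℝ :=
  Z.a 0 + ∑ k ∈ Finset.range Z.L,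
    (Z.a (k + 1) - Z.a k) * max 0 (min 1 ((x - Z.t k) / (Z.t (k + 1) - Z.t k)))

theorem continuous_toFun : Continuous Z.toFun := by
  unfold toFun
  fun_prop

theorem toFun_eq {k : ℕ} (hk : k < Z.L) {x : ℝ} (h1 : Z.t k ≤ x) (h2 : x ≤ Z.t (k + 1)) :
    Z.toFun x = Z.a k + (Z.a (k + 1) - Z.a k) * ((x - Z.t k) / (Z.t (k + 1) - Z.t k)) := by
  have hbefore : ∀ l ∈ Finset.range k, (Z.a (l + 1) - Z.a l) *
      max 0 (min 1 ((x - Z.t l) / (Z.t (l + 1) - Z.t l))) = Z.a (l + 1) - Z.a l := by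
    intro l hl
    have hl := Finset.mem_range.1 hl
    -- A constant piece lasts no time and its quotient is a division by zero, but its increment
    -- vanishes.
    rcases eq_or_ne (Z.a (l + 1) - Z.a l) 0 with h0 | h0
    · simp [h0]
    have hd : 0 < Z.t (l + 1) - Z.t l := by
      rw [t_succ]
      have := mul_pos (Z.c_pos l (by omega)) (abs_pos.2 h0)
      linarith
    have := Z.t_mono (show l + 1 ≤ k by omega) hk.le
    rw [min_eq_left ((one_le_div hd).2 (by linarith)), max_eq_right zero_le_one, mul_one]
  have hafter : ∀ r ∈ Finset.range (Z.L - (k + 1)), (Z.a (k + 1 + r + 1) - Z.a (k + 1 + r)) *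
      max 0 (min 1 ((x - Z.t (k + 1 + r)) / (Z.t (k + 1 + r + 1) - Z.t (k + 1 + r)))) = 0 := by
    intro r hr
    have hr := Finset.mem_range.1 hr
    have h3 := Z.t_mono (show k + 1 ≤ k + 1 + r by omega) (by omega)
    have h4 := Z.t_le_succ (show k + 1 + r < Z.L by omega)
    rw [max_eq_left, mul_zero]
    exact (min_le_right _ _).trans (div_nonpos_of_nonpos_of_nonneg (by linarith) (by linarith))
  have hL : Z.L = k + 1 + (Z.L - (k + 1)) := by omega
  have hd : 0 ≤ Z.t (k + 1) - Z.t k := by linarith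
  rw [toFun, hL, Finset.sum_range_add, Finset.sum_eq_zero hafter, Finset.sum_range_succ,
    Finset.sum_congr rfl hbefore, Finset.sum_range_sub,
    min_eq_right (div_le_one_of_le₀ (by linarith) hd),
    max_eq_right (div_nonneg (by linarith) hd)]
  ring

theorem exists_piece {x : ℝ} (h0 : 0 < x) (h1 : x ≤ Z.t Z.L) :
    ∃ k < Z.L, Z.t k < x ∧ x ≤ Z.t (k + 1) := by
  classical
  have hex : ∃ k, x ≤ Z.t k := ⟨_, h1⟩
  have hle : Nat.find hex ≤ Z.L := Nat.find_min' hex h1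
  have hs := Nat.find_spec hex
  have hm := fun k => Nat.find_min (m := k) hex
  rcases hk : Nat.find hex with _ | k
  · rw [hk, t_zero] at hs
    linarith
  · rw [hk] at hs hm hle
    exact ⟨k, by omega, not_le.1 (hm k (by omega)), hs⟩

theorem toFun_mem_segment {k : ℕ} (hk : k < Z.L) {x : ℝ} (h1 : Z.t k ≤ x) (h2 : x ≤ Z.t (k + 1)) :
    ∃ θ ∈ Set.Icc (0 : ℝ) 1, Z.toFun x = (1 - θ) * Z.a k + θ * Z.a (k + 1) := by
  refine ⟨(x - Z.t k) / (Z.t (k + 1) - Z.t k), ⟨div_nonneg (by linarith) (by linarith),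
    div_le_one_of_le₀ (by linarith) (by linarith)⟩, ?_⟩
  rw [Z.toFun_eq hk h1 h2]
  ring

theorem volume_affine_preimage {p q : ℝ} (hp : p ≠ 0) (B : Set ℝ) :
    volume ((fun x => q + p * x) ⁻¹' B) = ENNReal.ofReal |p⁻¹| * volume B := by
  have : (fun x => q + p * x) ⁻¹' B = (fun x => p * x) ⁻¹' ((fun x => q + x) ⁻¹' B) := rfl
  rw [this, Real.volume_preimage_mul_left hp, measure_preimage_add]

theorem volume_Ioc_inter_preimage {k : ℕ} (hk : k < Z.L) (A : Set ℝ) :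
    volume (Set.Ioc (Z.t k) (Z.t (k + 1)) ∩ Z.toFun ⁻¹' A) =
      ENNReal.ofReal (Z.c k) * volume (A ∩ Set.uIoc (Z.a k) (Z.a (k + 1))) := by
  have hc := Z.c_pos k hk
  have ht := Z.t_succ k
  set d := Z.t (k + 1) - Z.t k with hd
  set D := Z.a (k + 1) - Z.a k with hD
  have hdD : d = Z.c k * |D| := by rw [hd, ht]; ring
  rcases eq_or_ne D 0 with h0 | h0
  · have h1 : Z.t (k + 1) = Z.t k := by rw [h0] at hdD; simp at hdD; linarith
    have h2 : Z.a (k + 1) = Z.a k := by linarith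
    simp [h1, h2]
  have hdpos : 0 < d := by rw [hdD]; exact mul_pos hc (abs_pos.2 h0)
  have hp : D / d ≠ 0 := div_ne_zero h0 hdpos.ne'
  have hform : ∀ x ∈ Set.Ioc (Z.t k) (Z.t (k + 1)),
      Z.toFun x = (Z.a k - D / d * Z.t k) + D / d * x := by
    intro x hx
    rw [Z.toFun_eq hk hx.1.le hx.2]
    ring
  set φ : ℝ → ℝ := fun x => (Z.a k - D / d * Z.t k) + D / d * x with hφ
  have e1 : (Set.Ioc (Z.t k) (Z.t (k + 1)) ∩ Z.toFun ⁻¹' A : Set ℝ) =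
      Set.Ioc (Z.t k) (Z.t (k + 1)) ∩ φ ⁻¹' A := by
    ext x
    simp only [Set.mem_inter_iff, Set.mem_preimage]
    exact and_congr_right fun hx => by rw [hform x hx]
  -- Open intervals treat both directions alike: a decreasing piece would exchange the closed and
  -- the open endpoint. The endpoints are null.
  have e2 : Set.Ioo (Z.t k) (Z.t (k + 1)) ∩ φ ⁻¹' A =
      φ ⁻¹' (A ∩ Set.uIoo (Z.a k) (Z.a (k + 1))) := by
    have hφ1 : ∀ x, φ x - Z.a k = D / d * (x - Z.t k) := fun x => by simp only [hφ]; ring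
    have hφ2 : ∀ x, φ x - Z.a (k + 1) = D / d * (x - Z.t (k + 1)) := fun x => by
      have h5 : Z.t (k + 1) = d + Z.t k := by rw [hd]; ring
      have h6 : Z.a (k + 1) = D + Z.a k := by rw [hD]; ring
      simp only [hφ]
      rw [h5, h6]
      field_simp
      ring
    ext x
    have hx1 := hφ1 x
    have hx2 := hφ2 x
    simp only [Set.mem_inter_iff, Set.mem_preimage, Set.mem_Ioo, and_comm (b := φ x ∈ A)]
    refine and_congr_right fun _ => ?_
    rcases h0.lt_or_gt with hneg | hpos
    · have hs : D / d < 0 := div_neg_of_neg_of_pos hneg hdpos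
      rw [Set.uIoo_of_gt (by linarith), Set.mem_Ioo]
      constructor
      · rintro ⟨h1, h2⟩
        constructor
        · have := mul_pos_of_neg_of_neg hs (sub_neg.2 h2); linarith
        · have := mul_neg_of_neg_of_pos hs (sub_pos.2 h1); linarith
      · rintro ⟨h1, h2⟩
        constructor
        · by_contra h
          have := mul_nonneg_of_nonpos_of_nonpos hs.le (sub_nonpos.2 (not_lt.1 h)); linarith
        · by_contra h
          have := mul_nonpos_of_nonpos_of_nonneg hs.le (sub_nonneg.2 (not_lt.1 h)); linarith
    · have hs : 0 < D / d := div_pos hpos hdpos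
      rw [Set.uIoo_of_lt (by linarith), Set.mem_Ioo]
      constructor
      · rintro ⟨h1, h2⟩
        constructor
        · have := mul_pos hs (sub_pos.2 h1); linarith
        · have := mul_neg_of_pos_of_neg hs (sub_neg.2 h2); linarith
      · rintro ⟨h1, h2⟩
        constructor
        · by_contra h
          have := mul_nonpos_of_nonneg_of_nonpos hs.le (sub_nonpos.2 (not_lt.1 h)); linarith
        · by_contra h
          have := mul_nonneg hs.le (sub_nonneg.2 (not_lt.1 h)); linarith
  have hinv : |(D / d)⁻¹| = Z.c k := by
    rw [inv_div, abs_div, abs_of_pos hdpos, hdD]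
    field_simp
  rw [e1, ← measure_congr (Ioo_ae_eq_Ioc.inter (ae_eq_refl (φ ⁻¹' A))), e2,
    volume_affine_preimage hp, hinv]
  congr 1
  exact measure_congr ((ae_eq_refl A).inter Ioo_ae_eq_Ioc)

/-- This is the identity `cover` integrated over `A`. With the volume of each piece's preimage it
gives measure preservation, and with `A` the whole line it gives total time `1`. -/
theorem sum_volume_inter (A : Set ℝ) :
    ∑ k ∈ Finset.range Z.L, ENNReal.ofReal (Z.c k) *
      volume (A ∩ Set.uIoc (Z.a k) (Z.a (k + 1))) = volume (A ∩ Set.Ioc (0 : ℝ) 1) := by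
  have h1 : ∀ k, ENNReal.ofReal (Z.c k) * volume (A ∩ Set.uIoc (Z.a k) (Z.a (k + 1))) =
      ∫⁻ y in A, (Set.uIoc (Z.a k) (Z.a (k + 1))).indicator
        (fun _ => ENNReal.ofReal (Z.c k)) y := fun k => by
    rw [lintegral_indicator_const measurableSet_uIoc, Measure.restrict_apply measurableSet_uIoc,
      Set.inter_comm]
  have h2 : volume (A ∩ Set.Ioc (0 : ℝ) 1) =
      ∫⁻ y in A, (Set.Ioc (0 : ℝ) 1).indicator (fun _ => 1) y := by
    rw [lintegral_indicator_const measurableSet_Ioc, Measure.restrict_apply measurableSet_Ioc,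
      Set.inter_comm, one_mul]
  rw [Finset.sum_congr rfl fun k _ => h1 k, h2, ← lintegral_finsetSum _ fun k _ =>
    measurable_const.indicator measurableSet_uIoc]
  congr 1
  ext y
  by_cases hy : y ∈ Set.Ioc (0 : ℝ) 1
  · rw [Set.indicator_of_mem hy, ← ENNReal.ofReal_one, ← Z.cover y hy, ENNReal.ofReal_sum_of_nonneg]
    · refine Finset.sum_congr rfl fun k _ => ?_
      by_cases h : y ∈ Set.uIoc (Z.a k) (Z.a (k + 1)) <;> simp [h]
    · exact fun k hk => Set.indicator_nonneg (fun _ _ => (Z.c_pos k (Finset.mem_range.1 hk)).le) _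
  · rw [Set.indicator_of_notMem hy]
    refine Finset.sum_eq_zero fun k hk => Set.indicator_of_notMem (fun h => hy ?_) _
    have hk := Finset.mem_range.1 hk
    exact ⟨(le_inf (Z.mem k hk.le).1 (Z.mem (k + 1) hk).1).trans_lt h.1,
      h.2.trans (sup_le (Z.mem k hk.le).2 (Z.mem (k + 1) hk).2)⟩

theorem t_last : Z.t Z.L = 1 := by
  have h := Z.sum_volume_inter Set.univ
  simp only [Set.univ_inter, Real.volume_Ioc, Real.volume_uIoc, sub_zero, ENNReal.ofReal_one] at h
  have h2 : ENNReal.ofReal (Z.t Z.L) = 1 := by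
    rw [← h, t, ENNReal.ofReal_sum_of_nonneg]
    · exact Finset.sum_congr rfl fun k hk =>
        ENNReal.ofReal_mul (Z.c_pos k (Finset.mem_range.1 hk)).le
    · exact fun k hk => mul_nonneg (Z.c_pos k (Finset.mem_range.1 hk)).le (abs_nonneg _)
  simpa using h2

theorem iUnion_Ioc_eq : ⋃ k ∈ Finset.range Z.L, Set.Ioc (Z.t k) (Z.t (k + 1)) = Set.Ioc 0 1 := by
  ext x
  simp only [Set.mem_iUnion, Finset.mem_range, exists_prop]
  constructor
  · rintro ⟨k, hk, h⟩
    have h1 := Z.t_mono k.zero_le hk.le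
    have h2 := Z.t_mono (Nat.succ_le_of_lt hk) le_rfl
    rw [t_zero] at h1
    rw [t_last] at h2
    exact ⟨h1.trans_lt h.1, h.2.trans h2⟩
  · rintro ⟨h0, h1⟩
    exact Z.exists_piece h0 (by rwa [t_last])

theorem disjoint_Ioc {k l : ℕ} (hk : k < Z.L) (hl : l < Z.L) (hkl : k ≠ l) :
    Disjoint (Set.Ioc (Z.t k) (Z.t (k + 1))) (Set.Ioc (Z.t l) (Z.t (l + 1))) := by
  rw [Set.disjoint_left]
  intro x hx hx'
  rcases hkl.lt_or_gt with h | h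
  · exact absurd (hx'.1.trans_le (hx.2.trans (Z.t_mono (Nat.succ_le_of_lt h) hl.le))) (lt_irrefl _)
  · exact absurd (hx.1.trans_le (hx'.2.trans (Z.t_mono (Nat.succ_le_of_lt h) hk.le))) (lt_irrefl _)

theorem volume_Ioc_zero_one_inter_preimage {A : Set ℝ} (hA : MeasurableSet A) :
    volume (Set.Ioc (0 : ℝ) 1 ∩ Z.toFun ⁻¹' A) = volume (A ∩ Set.Ioc (0 : ℝ) 1) := by
  rw [← Z.iUnion_Ioc_eq, Set.iUnion₂_inter, measure_biUnion_finset, Z.iUnion_Ioc_eq,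
    ← Z.sum_volume_inter A]
  · exact Finset.sum_congr rfl fun k hk =>
      Z.volume_Ioc_inter_preimage (Finset.mem_range.1 hk) A
  · intro k hk l hl hkl
    exact (Z.disjoint_Ioc (Finset.mem_range.1 hk) (Finset.mem_range.1 hl) hkl).mono
      Set.inter_subset_left Set.inter_subset_left
  · exact fun k _ => measurableSet_Ioc.inter (Z.continuous_toFun.measurable hA)

theorem L_pos : 0 < Z.L := by
  by_contra h
  have h0 : Z.L = 0 := by omega
  have := Z.t_last
  rw [h0, t_zero] at this
  exact zero_ne_one this

theorem exists_closed_piece {x : ℝ} (hx : x ∈ Set.Icc (0 : ℝ) 1) :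
    ∃ k < Z.L, Z.t k ≤ x ∧ x ≤ Z.t (k + 1) := by
  rcases hx.1.eq_or_lt with rfl | h0
  · refine ⟨0, Z.L_pos, Z.t_zero.le, ?_⟩
    rw [← Z.t_zero]
    exact Z.t_le_succ Z.L_pos
  · obtain ⟨k, hk, h1, h2⟩ := Z.exists_piece h0 (by rw [t_last]; exact hx.2)
    exact ⟨k, hk, h1.le, h2⟩

theorem toFun_mem {x : ℝ} (hx : x ∈ Set.Icc (0 : ℝ) 1) : Z.toFun x ∈ Set.Icc (0 : ℝ) 1 := by
  obtain ⟨k, hk, h1, h2⟩ := Z.exists_closed_piece hx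
  obtain ⟨θ, hθ, h⟩ := Z.toFun_mem_segment hk h1 h2
  rw [h]
  exact convex_Icc (0 : ℝ) 1 (Z.mem k hk.le) (Z.mem (k + 1) hk) (by linarith [hθ.2]) hθ.1 (by ring)

/-- On a piece the path is a convex combination of its two turning points, so closeness need only be
checked there. -/
theorem abs_toFun_sub_le {x y ε : ℝ} (hx : x ∈ Set.Icc (0 : ℝ) 1)
    (h : ∀ k < Z.L, Z.t k ≤ x → x ≤ Z.t (k + 1) → |Z.a k - y| ≤ ε ∧ |Z.a (k + 1) - y| ≤ ε) :
    |Z.toFun x - y| ≤ ε := by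
  obtain ⟨k, hk, h1, h2⟩ := Z.exists_closed_piece hx
  obtain ⟨θ, hθ, e⟩ := Z.toFun_mem_segment hk h1 h2
  obtain ⟨h3, h4⟩ := h k hk h1 h2
  have : Z.toFun x - y = (1 - θ) * (Z.a k - y) + θ * (Z.a (k + 1) - y) := by rw [e]; ring
  have h5 := mul_le_mul_of_nonneg_left h3 (sub_nonneg.2 hθ.2)
  have h6 := mul_le_mul_of_nonneg_left h4 hθ.1
  rw [this]
  refine (abs_add_le _ _).trans ?_
  rw [abs_mul, abs_mul, abs_of_nonneg (sub_nonneg.2 hθ.2), abs_of_nonneg hθ.1]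
  linarith

/-- The path, as a continuous self-map of the unit interval. -/
noncomputable def map : C(unitInterval, unitInterval) where
  toFun x := ⟨Z.toFun x, Z.toFun_mem x.2⟩
  continuous_toFun := (Z.continuous_toFun.comp continuous_subtype_val).subtype_mk _

theorem coe_map (x : unitInterval) : (Z.map x : ℝ) = Z.toFun x := rfl

theorem image_preimage_map (A : Set unitInterval) :
    ((↑) : unitInterval → ℝ) '' (Z.map ⁻¹' A) =
      Set.Icc 0 1 ∩ Z.toFun ⁻¹' (((↑) : unitInterval → ℝ) '' A) := by
  ext x
  constructor
  · rintro ⟨y, hy, rfl⟩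
    exact ⟨y.2, Z.map y, hy, rfl⟩
  · rintro ⟨hx, y, hy, hyx⟩
    refine ⟨⟨x, hx⟩, ?_, rfl⟩
    have : Z.map ⟨x, hx⟩ = y := Subtype.ext hyx.symm
    rwa [Set.mem_preimage, this]

theorem measurePreserving_map : MeasurePreserving Z.map volume volume where
  measurable := Z.map.continuous.measurable
  map_eq := by
    ext A hA
    have hA' := unitInterval.measurableEmbedding_coe.measurableSet_image.2 hA
    have e : ∀ B : Set ℝ, volume (Set.Ioc 0 1 ∩ B) = volume (Set.Icc 0 1 ∩ B) := fun B =>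
      measure_congr (Ioc_ae_eq_Icc.inter (ae_eq_refl B))
    rw [Measure.map_apply Z.map.continuous.measurable hA, unitInterval.volume_apply,
      unitInterval.volume_apply, image_preimage_map, ← e,
      Z.volume_Ioc_zero_one_inter_preimage hA', Set.inter_comm, e]
    congr 1
    exact Set.inter_eq_right.2 fun _ ⟨y, _, h⟩ => h ▸ y.2

/-- The set of times of the `k`-th piece. -/
def piece (k : ℕ) : Set unitInterval := {x | (x : ℝ) ∈ Set.Ioc (Z.t k) (Z.t (k + 1))}

theorem measurableSet_piece (k : ℕ) : MeasurableSet (Z.piece k) :=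
  measurable_subtype_coe measurableSet_Ioc

theorem volume_piece_inter_preimage_le {k : ℕ} (hk : k < Z.L) (A : Set unitInterval) :
    volume (Z.piece k ∩ Z.map ⁻¹' A) ≤ ENNReal.ofReal (Z.c k) * volume A := by
  have h : ((↑) : unitInterval → ℝ) '' (Z.piece k ∩ Z.map ⁻¹' A) ⊆
      Set.Ioc (Z.t k) (Z.t (k + 1)) ∩ Z.toFun ⁻¹' (((↑) : unitInterval → ℝ) '' A) := by
    rintro _ ⟨x, ⟨h1, h2⟩, rfl⟩
    exact ⟨h1, Z.map x, h2, rfl⟩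
  rw [unitInterval.volume_apply, unitInterval.volume_apply (s := A)]
  refine (measure_mono h).trans ?_
  rw [Z.volume_Ioc_inter_preimage hk]
  gcongr
  exact Set.inter_subset_left

theorem exists_mem_piece {x : unitInterval} (hx : x ≠ 0) : ∃ k < Z.L, x ∈ Z.piece k := by
  refine Z.exists_piece (x := x) (unitInterval.pos_iff_ne_zero.2 hx) ?_
  rw [t_last]
  exact x.2.2

end Zigzag

/-! ### Upper bounds for pattern densities -/

/-- The product outer measure is the largest one bounded on boxes by the product of the sides.
Comparison on boxes therefore suffices, but the sides may be arbitrary sets, which is why `h` is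
required for all `s`. -/
theorem Measure.pi_le_prod_mul_pi {ι α : Type*} [Fintype ι] [MeasurableSpace α]
    {ν μ : ι → Measure α} [∀ i, SigmaFinite (ν i)] [∀ i, SigmaFinite (μ i)] {C : ι → ENNReal}
    (hC : ∀ i, C i ≠ ⊤) (h : ∀ i s, ν i s ≤ C i * μ i s) {s : Set (ι → α)} (hs : MeasurableSet s) :
    Measure.pi ν s ≤ (∏ i, C i) * Measure.pi μ s := by
  have hfin : ∀ i, SigmaFinite (C i • μ i) := fun i => by
    lift C i to NNReal using hC i with c
    exact inferInstanceAs (SigmaFinite ((c : NNReal) • μ i))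
  have e : Measure.pi (fun i => C i • μ i) = (∏ i, C i) • Measure.pi μ :=
    Measure.pi_eq fun s _ => by simp [Measure.pi_pi, Finset.prod_mul_distrib]
  have : (Measure.pi ν).toOuterMeasure ≤
      OuterMeasure.pi fun i => (C i • μ i).toOuterMeasure := by
    refine OuterMeasure.le_pi.2 fun s _ => ?_
    have := Measure.pi_pi ν s
    exact this.trans_le (Finset.prod_le_prod' fun i _ => h i (s i))
  calc Measure.pi ν s ≤ OuterMeasure.pi (fun i => (C i • μ i).toOuterMeasure) s := this s
    _ = Measure.pi (fun i => C i • μ i) s := by rw [Measure.pi, toMeasure_apply _ _ hs]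
    _ = (∏ i, C i) * Measure.pi μ s := by rw [e]; rfl

/-- The event that `n` numbers are ordered as the values of `ρ`. -/
def orderEvent {n : ℕ} (ρ : Equiv.Perm (Fin n)) : Set (Fin n → unitInterval) :=
  {y | ∀ i j, ρ i < ρ j ↔ y i < y j}

theorem mem_orderEvent {n : ℕ} {ρ : Equiv.Perm (Fin n)} {y : Fin n → unitInterval} :
    y ∈ orderEvent ρ ↔ ∀ i j, ρ i < ρ j ↔ y i < y j :=
  Iff.rfl

theorem measurableSet_orderEvent {n : ℕ} (ρ : Equiv.Perm (Fin n)) :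
    MeasurableSet (orderEvent ρ) := by
  simp only [orderEvent, Set.ofPred_forall]
  refine .iInter fun i => .iInter fun j => ?_
  have : MeasurableSet {y : Fin n → unitInterval | y i < y j} :=
    measurableSet_lt (by fun_prop) (by fun_prop)
  by_cases h : ρ i < ρ j <;> simp only [h, true_iff, false_iff]
  exacts [this, this.compl]

theorem volume_orderEvent_eq {n : ℕ} (ρ : Equiv.Perm (Fin n)) :
    volume (orderEvent ρ) = volume (orderEvent (1 : Equiv.Perm (Fin n))) := by
  have hp := volume_measurePreserving_piCongrLeft (fun _ : Fin n => unitInterval) ρ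
  rw [← hp.measure_preimage (measurableSet_orderEvent 1).nullMeasurableSet]
  congr 1
  ext y
  simp only [Set.mem_preimage, mem_orderEvent, Equiv.Perm.one_apply]
  have h : ∀ i, (MeasurableEquiv.piCongrLeft (fun _ : Fin n => unitInterval) ρ) y (ρ i) = y i :=
    fun i => Equiv.piCongrLeft_apply_apply (fun _ : Fin n => unitInterval) ρ y i
  constructor
  · intro h1 i j
    obtain ⟨i, rfl⟩ := ρ.surjective i
    obtain ⟨j, rfl⟩ := ρ.surjective j
    rw [h, h]
    exact h1 i j
  · intro h1 i j
    have := h1 (ρ i) (ρ j)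
    rwa [h, h] at this

/-- The `n!` order events are disjoint and, by relabelling coordinates, equally likely. -/
theorem volume_orderEvent_le {n : ℕ} (ρ : Equiv.Perm (Fin n)) :
    volume (orderEvent ρ) ≤ (n.factorial : ENNReal)⁻¹ := by
  have h : ∑ ρ : Equiv.Perm (Fin n), volume (orderEvent ρ) ≤ 1 := by
    rw [← measure_biUnion_finset _ fun ρ _ => measurableSet_orderEvent ρ]
    · exact prob_le_one
    · intro ρ _ ρ' _ hne
      exact Set.disjoint_left.2 fun y h h' => hne (perm_eq_of_lt_iff fun i j =>
        (mem_orderEvent.1 h i j).trans (mem_orderEvent.1 h' i j).symm)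
  simp only [volume_orderEvent_eq, Finset.sum_const, Finset.card_univ, Fintype.card_perm,
    Fintype.card_fin, nsmul_eq_mul] at h
  rw [volume_orderEvent_eq, ← one_div, ENNReal.le_div_iff_mul_le (by simp [n.factorial_ne_zero])
    (by simp), mul_comm]
  exact h

/-- The height of a point restricted to a piece of cost `c` has law at most `c` times Lebesgue
measure, and composing with the measure-preserving `f` keeps this bound. The product over
coordinates is then compared on the order event. -/
theorem volume_pieces_inter_orderEvent_le (Z : Zigzag) {f : unitInterval → unitInterval}
    (hf : MeasurePreserving f volume volume) {n : ℕ} (q : Fin n → ℕ) (hq : ∀ i, q i < Z.L)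
    (ρ : Equiv.Perm (Fin n)) :
    volume (Set.univ.pi (fun i => Z.piece (q i)) ∩
      (fun (x : Fin n → unitInterval) i => f (Z.map (x i))) ⁻¹' orderEvent ρ) ≤
      (∏ i, ENNReal.ofReal (Z.c (q i))) * (n.factorial : ENNReal)⁻¹ := by
  have hm : Measurable fun x => f (Z.map x) := hf.measurable.comp Z.map.continuous.measurable
  have hm' : Measurable (fun (x : Fin n → unitInterval) i => f (Z.map (x i))) :=
    measurable_pi_lambda _ fun i => hm.comp (measurable_pi_apply i)
  have hν : ∀ i s, (volume.restrict (Z.piece (q i))).map (fun x => f (Z.map x)) s ≤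
      ENNReal.ofReal (Z.c (q i)) * volume s := by
    intro i s
    have hs := measurableSet_toMeasurable volume s
    rw [← measure_toMeasurable (μ := volume) s]
    refine (measure_mono (subset_toMeasurable volume s)).trans ?_
    rw [Measure.map_apply hm hs, Measure.restrict_apply (hm hs), Set.inter_comm]
    refine (Z.volume_piece_inter_preimage_le (hq i) (f ⁻¹' toMeasurable volume s)).trans ?_
    rw [hf.measure_preimage hs.nullMeasurableSet]
  rw [Set.inter_comm, ← Measure.restrict_apply (hm' (measurableSet_orderEvent ρ)), volume_pi,
    Measure.restrict_pi_pi, ← Measure.map_apply hm' (measurableSet_orderEvent ρ),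
    Measure.pi_map_pi (f := fun _ x => f (Z.map x)) (fun _ => hm.aemeasurable)]
  refine (Measure.pi_le_prod_mul_pi (μ := fun _ => volume) (fun i => ENNReal.ofReal_ne_top) hν
    (measurableSet_orderEvent ρ)).trans ?_
  gcongr
  exact volume_orderEvent_le ρ

/-- The event that two of `n` points are at distance at most `δ`. -/
def closeEvent (n : ℕ) (δ : ℝ) : Set (Fin n → unitInterval) :=
  {x | ∃ i j, i ≠ j ∧ |(x i : ℝ) - x j| ≤ δ}

theorem mem_closeEvent {n : ℕ} {δ : ℝ} {x : Fin n → unitInterval} :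
    x ∈ closeEvent n δ ↔ ∃ i j, i ≠ j ∧ |(x i : ℝ) - x j| ≤ δ :=
  Iff.rfl

theorem measurableSet_closeEvent (n : ℕ) (δ : ℝ) : MeasurableSet (closeEvent n δ) := by
  simp only [closeEvent, Set.ofPred_exists, Set.ofPred_and]
  exact .iUnion fun i => .iUnion fun j => (MeasurableSet.const _).inter
    (measurableSet_le (by fun_prop) (by fun_prop))

/-- Continuity from above: as `δ` decreases to `0` only samples with a repeated point remain, and
these are null. -/
theorem exists_volume_closeEvent_lt (n : ℕ) {ε : ENNReal} (hε : 0 < ε) :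
    ∃ δ > 0, volume (closeEvent n δ) < ε := by
  have hanti : Antitone fun k : ℕ => closeEvent n (1 / ((k : ℝ) + 1)) := by
    intro k l hkl x hx
    obtain ⟨i, j, hij, h⟩ := mem_closeEvent.1 hx
    exact ⟨i, j, hij, h.trans (one_div_le_one_div_of_le (by positivity) (by gcongr))⟩
  have h := tendsto_measure_iInter_atTop (μ := (volume : Measure (Fin n → unitInterval)))
    (fun k : ℕ => (measurableSet_closeEvent n (1 / ((k : ℝ) + 1))).nullMeasurableSet) hanti
    ⟨0, measure_ne_top _ _⟩
  have h0 : volume (⋂ k : ℕ, closeEvent n (1 / ((k : ℝ) + 1))) = 0 := by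
    refine measure_mono_null (fun x hx => ?_) (ae_iff.1 (ae_injective n))
    intro hinj
    have hev : ∀ i j, i ≠ j → ∀ᶠ k : ℕ in atTop, 1 / ((k : ℝ) + 1) < |(x i : ℝ) - x j| := by
      intro i j hij
      refine tendsto_one_div_add_atTop_nhds_zero_nat.eventually_lt_const (abs_pos.2 ?_)
      exact sub_ne_zero.2 fun h => hij (hinj (Subtype.ext h))
    obtain ⟨k, hk⟩ := (eventually_all.2 fun i => eventually_all.2 fun j =>
      eventually_all.2 (hev i j)).exists
    obtain ⟨i, j, hij, h⟩ := mem_closeEvent.1 (Set.mem_iInter.1 hx k)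
    exact (hk i j hij).not_ge h
  rw [h0] at h
  obtain ⟨k, hk⟩ := (h.eventually_lt_const hε).exists
  exact ⟨_, by positivity, hk⟩

/-- Outside `closeEvent` the points occupy distinct pieces. The assignment `q` of pieces then
determines the sorting permutation, so the pattern prescribes one order of the heights. Summing `∏ c
(q i)` over all `q` gives the `n`-th power of the total cost. -/
theorem volume_patternEvent_comp_le (Z : Zigzag) {f : unitInterval → unitInterval}
    (hf : MeasurePreserving f volume volume) {δ : ℝ}
    (hδ : ∀ k < Z.L, Z.t (k + 1) - Z.t k ≤ δ) {n : ℕ} (σ : Equiv.Perm (Fin n)) :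
    volume (patternEvent (f ∘ Z.map) σ) ≤ volume (closeEvent n δ) +
      (∑ k ∈ Finset.range Z.L, ENNReal.ofReal (Z.c k)) ^ n * (n.factorial : ENNReal)⁻¹ := by
  classical
  set E : (Fin n → ℕ) → Set (Fin n → unitInterval) := fun q =>
    {x | x ∈ Set.univ.pi (fun i => Z.piece (q i)) ∧ x ∈ patternEvent (f ∘ Z.map) σ ∧
      Function.Injective q} with hE
  set Q := Fintype.piFinset fun _ : Fin n => Finset.range Z.L with hQ
  have hcover : patternEvent (f ∘ Z.map) σ ≤ᵐ[volume] (closeEvent n δ ∪ ⋃ q ∈ Q, E q : Set _) := by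
    have h0 : ∀ᵐ x : Fin n → unitInterval, ∀ i, x i ≠ 0 := by
      refine ae_all_iff.2 fun i => ?_
      have : ∀ᵐ y : unitInterval, y ≠ 0 := by simp [ae_iff]
      exact (measurePreserving_eval (fun _ : Fin n => (volume : Measure unitInterval)) i).quasiMeasurePreserving.ae this
    filter_upwards [h0] with x hx hσ
    choose q hqL hq using fun i => Z.exists_mem_piece (hx i)
    by_cases hinj : Function.Injective q
    · refine Or.inr (Set.mem_iUnion₂.2 ⟨q, ?_, fun i _ => hq i, hσ, hinj⟩)
      exact Fintype.mem_piFinset.2 fun i => Finset.mem_range.2 (hqL i)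
    · refine Or.inl ?_
      simp only [Function.Injective, not_forall] at hinj
      obtain ⟨i, j, hij, hne⟩ := hinj
      have hi := hq i
      have hj := hq j
      rw [← hij] at hj
      have := hδ (q i) (hqL i)
      exact ⟨i, j, hne, abs_le.2 ⟨by linarith [hi.1, hj.2], by linarith [hi.2, hj.1]⟩⟩
  refine (measure_mono_ae hcover).trans ((measure_union_le _ _).trans ?_)
  gcongr
  refine (measure_biUnion_finset_le _ _).trans ?_
  rw [Finset.sum_pow', Finset.sum_mul]
  refine Finset.sum_le_sum fun q hq => ?_
  have hqL : ∀ i, q i < Z.L := fun i => Finset.mem_range.1 (Fintype.mem_piFinset.1 hq i)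
  rcases (E q).eq_empty_or_nonempty with he | ⟨x₀, hx₀, hσ₀, hinj⟩
  · rw [he, measure_empty]
    exact zero_le
  -- For injective `q`, sorting the points sorts their pieces, so the sorting permutation is the
  -- same for all `x` in `E q`.
  have hsort : ∀ x ∈ Set.univ.pi (fun i => Z.piece (q i)), ∀ τ : Equiv.Perm (Fin n),
      StrictMono (fun i => x (τ i)) → StrictMono (q ∘ τ) := by
    intro x hx τ hτ i j hij
    by_contra hcon
    have hlt := lt_of_le_of_ne (not_lt.1 hcon) fun h => hij.ne' (τ.injective (hinj h))
    have h1 : (x (τ j) : ℝ) ≤ Z.t (q (τ j) + 1) := (hx (τ j) trivial).2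
    have h2 : Z.t (q (τ i)) < x (τ i) := (hx (τ i) trivial).1
    have h3 := Z.t_mono (Nat.succ_le_of_lt hlt) (hqL _).le
    have h4 : (x (τ i) : ℝ) < x (τ j) := hτ hij
    simp only [Function.comp_apply, Nat.succ_eq_add_one] at h3
    linarith
  obtain ⟨τ, hτ, -⟩ := mem_patternEvent.1 hσ₀
  refine (measure_mono fun x hx => ?_).trans
    (volume_pieces_inter_orderEvent_le Z hf q hqL (τ.symm.trans σ))
  obtain ⟨hx, hσ, -⟩ := hx
  refine ⟨hx, mem_orderEvent.2 fun i j => ?_⟩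
  obtain ⟨τ', hτ', h⟩ := mem_patternEvent.1 hσ
  obtain rfl : τ = τ' := sortingPerm_unique (hsort x₀ hx₀ τ hτ) (hsort x hx τ' hτ')
  simpa using h (τ.symm i) (τ.symm j)

/-! ### Maps of high entropy are dense -/

/-- The block `j` with `y ∈ (j/m, (j+1)/m]`. -/
theorem exists_block {m : ℕ} (hm : 0 < m) {y : ℝ} (hy : y ∈ Set.Ioc (0 : ℝ) 1) :
    ∃ j < m, ∀ i : ℕ, (i : ℝ) / m < y ↔ i ≤ j := by
  have hm' : (0 : ℝ) < m := by exact_mod_cast hm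
  have hpos : 0 < y * m := mul_pos hy.1 hm'
  have hc : 0 < ⌈y * m⌉₊ := Nat.ceil_pos.2 hpos
  have hcm : ⌈y * m⌉₊ ≤ m := Nat.ceil_le.2 (by nlinarith [hy.2])
  refine ⟨⌈y * m⌉₊ - 1, by omega, fun i => ?_⟩
  rw [div_lt_iff₀ hm', ← Nat.lt_ceil]
  omega

theorem mem_Ioc_div_iff {m : ℕ} {y : ℝ} {j : ℕ} (hj : ∀ i : ℕ, (i : ℝ) / m < y ↔ i ≤ j) (p q : ℕ) :
    y ∈ Set.Ioc ((p : ℝ) / m) ((q : ℝ) / m) ↔ p ≤ j ∧ j < q := by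
  rw [Set.mem_Ioc, ← not_lt, hj, hj, not_le]

/-- The `q`-th turning point, in units of `1/m`, of the path that traverses each block `k` times. -/
def combTurn (k q : ℕ) : ℕ := q / k + q % k % 2

/-- Oddness of `k` makes the last traversal of a block end at its upper endpoint, where the next
block starts. -/
theorem combTurn_succ {k : ℕ} (hk : Odd k) (q : ℕ) : combTurn k (q + 1) = q / k + (q % k + 1) % 2 := by
  obtain ⟨l, rfl⟩ := hk
  have hmod := Nat.mod_lt q (show 0 < 2 * l + 1 by omega)
  have hdiv := Nat.div_add_mod q (2 * l + 1)
  unfold combTurn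
  rcases eq_or_lt_of_le (Nat.succ_le_of_lt hmod) with h | h
  · have e : q + 1 = (2 * l + 1) * (q / (2 * l + 1) + 1) := by
      rw [mul_add, mul_one]; omega
    rw [e, Nat.mul_div_cancel_left _ (by omega), Nat.mul_mod_right]
    omega
  · have e : q + 1 = (q % (2 * l + 1) + 1) + (2 * l + 1) * (q / (2 * l + 1)) := by omega
    have e1 : (q + 1) % (2 * l + 1) = q % (2 * l + 1) + 1 := by
      conv_lhs => rw [e]
      rw [Nat.add_mul_mod_self_left, Nat.mod_eq_of_lt h]
    have e2 : (q + 1) / (2 * l + 1) = q / (2 * l + 1) := by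
      conv_lhs => rw [e]
      rw [Nat.add_mul_div_left _ _ (by omega), Nat.div_eq_of_lt h, zero_add]
    rw [e1, e2]

theorem combTurn_cases {k : ℕ} (hk : Odd k) (q : ℕ) :
    (combTurn k q = q / k ∧ combTurn k (q + 1) = q / k + 1) ∨
      (combTurn k q = q / k + 1 ∧ combTurn k (q + 1) = q / k) := by
  rw [combTurn_succ hk, combTurn]
  omega

theorem uIoc_combTurn {k : ℕ} (hk : Odd k) (m q : ℕ) :
    Set.uIoc ((combTurn k q : ℝ) / m) ((combTurn k (q + 1) : ℝ) / m) =
      Set.Ioc (((q / k : ℕ) : ℝ) / m) (((q / k + 1 : ℕ) : ℝ) / m) := by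
  have hle : ((q / k : ℕ) : ℝ) / m ≤ ((q / k + 1 : ℕ) : ℝ) / m := by gcongr; omega
  rcases combTurn_cases hk q with ⟨h1, h2⟩ | ⟨h1, h2⟩
  · rw [h1, h2, Set.uIoc_of_le hle]
  · rw [h1, h2, Set.uIoc_of_ge hle]

/-- The path that traverses each of the `m` blocks `[j/m, (j+1)/m]` in turn, `k` times. -/
noncomputable def comb (m k : ℕ) (hm : 0 < m) (hk : Odd k) : Zigzag where
  L := m * k
  a q := combTurn k q / m
  c _ := 1 / k
  mem q hq := by
    have hm' : (0 : ℝ) < m := by exact_mod_cast hm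
    refine ⟨by positivity, (div_le_one hm').2 ?_⟩
    have hk0 : 0 < k := hk.pos
    rcases hq.lt_or_eq with h | rfl
    · have := (Nat.div_lt_iff_lt_mul hk0).2 h
      have : combTurn k q ≤ m := by
        rcases combTurn_cases hk q with h | h <;> omega
      exact_mod_cast this
    · simp [combTurn, hk0]
  c_pos _ _ := by
    have : 0 < k := hk.pos
    positivity
  cover y hy := by
    have hk0 : 0 < k := hk.pos
    obtain ⟨j, hjm, hj⟩ := exists_block hm hy
    have : ∀ q, (Set.uIoc ((combTurn k q : ℝ) / m) ((combTurn k (q + 1) : ℝ) / m)).indicator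
        (fun _ => (1 : ℝ) / k) y = if q / k = j then (1 : ℝ) / k else 0 := by
      intro q
      rw [uIoc_combTurn hk, Set.indicator_apply]
      refine if_congr ?_ rfl rfl
      rw [mem_Ioc_div_iff hj]
      omega
    simp only [this]
    have hset : (Finset.range (m * k)).filter (fun q => q / k = j) =
        Finset.Ico (j * k) (j * k + k) := by
      ext q
      have h1 : (j + 1) * k ≤ m * k := Nat.mul_le_mul_right k hjm
      rw [Finset.mem_filter, Finset.mem_range, Finset.mem_Ico, Nat.div_eq_iff hk0]
      rw [add_mul, one_mul] at h1
      rw [mul_comm j k] at *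
      omega
    rw [← Finset.sum_filter, hset, Finset.sum_const, Nat.card_Ico, nsmul_eq_mul,
      add_tsub_cancel_left, mul_one_div_cancel (by positivity)]

theorem comb_t (m k : ℕ) (hm : 0 < m) (hk : Odd k) (q : ℕ) :
    (comb m k hm hk).t q = q / (m * k) := by
  have hm' : (0 : ℝ) < m := by exact_mod_cast hm
  have hk' : (0 : ℝ) < k := by exact_mod_cast hk.pos
  have : ∀ l, (comb m k hm hk).c l * |(comb m k hm hk).a (l + 1) - (comb m k hm hk).a l| =
      1 / (m * k) := by
    intro l
    have : |(combTurn k (l + 1) : ℝ) / m - combTurn k l / m| = 1 / m := by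
      rw [← sub_div, abs_div, abs_of_pos hm']
      congr 1
      rcases combTurn_cases hk l with ⟨h1, h2⟩ | ⟨h1, h2⟩ <;> rw [h1, h2] <;> push_cast
      · rw [add_sub_cancel_left, abs_one]
      · rw [sub_add_cancel_left, abs_neg, abs_one]
    change 1 / (k : ℝ) * |(combTurn k (l + 1) : ℝ) / m - combTurn k l / m| = _
    rw [this]
    field_simp
  rw [Zigzag.t, Finset.sum_congr rfl fun l _ => this l, Finset.sum_const, Finset.card_range,
    nsmul_eq_mul, mul_one_div]

/-- The `k` traversals of a block take exactly the length of the block, so time and position always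
share a block. -/
theorem abs_comb_sub_le (m k : ℕ) (hm : 0 < m) (hk : Odd k) {x : ℝ} (hx : x ∈ Set.Icc (0 : ℝ) 1) :
    |(comb m k hm hk).toFun x - x| ≤ 1 / m := by
  have hm' : (0 : ℝ) < m := by exact_mod_cast hm
  have hk' : (0 : ℝ) < k := by exact_mod_cast hk.pos
  refine (comb m k hm hk).abs_toFun_sub_le hx fun q _ h1 h2 => ?_
  rw [comb_t, div_le_iff₀ (by positivity)] at h1
  rw [comb_t, le_div_iff₀ (by positivity)] at h2
  have hlo : ((q / k : ℕ) : ℝ) / m ≤ x := by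
    rw [div_le_iff₀ hm']
    have : ((q / k : ℕ) : ℝ) * k ≤ q := by exact_mod_cast Nat.div_mul_le_self q k
    refine le_of_mul_le_mul_right ?_ hk'
    linarith
  have hhi : x ≤ ((q / k + 1 : ℕ) : ℝ) / m := by
    rw [le_div_iff₀ hm']
    have : ((q + 1 : ℕ) : ℝ) ≤ ((q / k + 1 : ℕ) : ℝ) * k := by
      exact_mod_cast Nat.lt_mul_of_div_lt (Nat.lt_succ_self (q / k)) hk.pos
    refine le_of_mul_le_mul_right ?_ hk'
    linarith
  have hsplit : ((q / k + 1 : ℕ) : ℝ) / m = ((q / k : ℕ) : ℝ) / m + 1 / m := by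
    push_cast
    ring
  rw [hsplit] at hhi
  have key : |((q / k : ℕ) : ℝ) / m - x| ≤ 1 / m ∧ |((q / k + 1 : ℕ) : ℝ) / m - x| ≤ 1 / m := by
    rw [hsplit]
    have : 0 < 1 / (m : ℝ) := by positivity
    constructor <;> exact abs_le.2 ⟨by linarith, by linarith⟩
  change |(combTurn k q : ℝ) / m - x| ≤ 1 / m ∧ |(combTurn k (q + 1) : ℝ) / m - x| ≤ 1 / m
  rcases combTurn_cases hk q with ⟨h1, h2⟩ | ⟨h1, h2⟩ <;> rw [h1, h2]
  exacts [key, key.symm]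

/-- The total cost is `m k · (1 / k) = m`, whatever `k` is. The factor `2` absorbs the close
samples, made as rare as the main term by `hclose`. -/
theorem density_comp_comb_le (f : CLambda) {m k : ℕ} (hm : 0 < m) (hk : Odd k) {n : ℕ} {δ : ℝ}
    (hδ : 1 / ((m : ℝ) * k) ≤ δ)
    (hclose : volume (closeEvent n δ) ≤ ENNReal.ofReal ((m : ℝ) ^ n / n.factorial))
    (hf : MeasurePreserving (f.1 ∘ (comb m k hm hk).map) volume volume) (σ : Equiv.Perm (Fin n)) :
    (graphPermuton _ hf).density σ ≤ 2 * ((m : ℝ) ^ n / n.factorial) := by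
  have hk' : (0 : ℝ) < k := by exact_mod_cast hk.pos
  have h := volume_patternEvent_comp_le (comb m k hm hk) f.2 (δ := δ) (fun q _ => by
    rw [comb_t, comb_t, ← sub_div]
    push_cast
    rw [add_sub_cancel_left]
    exact hδ) σ
  have hsum : ∑ q ∈ Finset.range (comb m k hm hk).L, ENNReal.ofReal ((comb m k hm hk).c q) =
      ENNReal.ofReal m := by
    change ∑ q ∈ Finset.range (m * k), ENNReal.ofReal (1 / k) = _
    rw [← ENNReal.ofReal_sum_of_nonneg fun _ _ => by positivity, Finset.sum_const,
      Finset.card_range, nsmul_eq_mul]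
    congr 1
    push_cast
    field_simp
  have hfac : (n.factorial : ENNReal)⁻¹ = ENNReal.ofReal ((n.factorial : ℝ)⁻¹) := by
    rw [ENNReal.ofReal_inv_of_pos (by positivity), ENNReal.ofReal_natCast]
  rw [hsum, hfac, ← ENNReal.ofReal_pow (by positivity), ← ENNReal.ofReal_mul (by positivity),
    ← div_eq_mul_inv] at h
  rw [density_graphPermuton]
  refine ENNReal.toReal_le_of_le_ofReal (by positivity) (h.trans ?_)
  rw [two_mul, ENNReal.ofReal_add (by positivity) (by positivity)]
  gcongr

theorem log_factorial_ge (n : ℕ) : n * Real.log n - n ≤ Real.log (n.factorial) := by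
  rcases n.eq_zero_or_pos with rfl | hn
  · simp
  have hn' : (0 : ℝ) < n := by exact_mod_cast hn
  have hf : (0 : ℝ) < n.factorial := by exact_mod_cast n.factorial_pos
  have h := Real.log_le_log (by positivity) (Real.pow_div_factorial_le_exp (x := n) hn'.le n)
  rw [Real.log_exp, Real.log_div (by positivity) hf.ne', Real.log_pow] at h
  linarith

theorem CLambda.dist_lt {f g : CLambda} {r : ℝ} (h : ∀ x, |(f.1 x : ℝ) - g.1 x| < r) :
    dist f g < r :=
  ContinuousMap.dist_lt_of_nonempty h

theorem exists_graphEntropy_gt (f : CLambda) {r ε : ℝ} (hr : 0 < r) (hε : 0 < ε) (N : ℕ) :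
    ∃ g : CLambda, dist g f < r ∧
      ∃ n ≥ N, (1 - ε) * (n * Real.log n) < graphEntropy g n := by
  -- Order of choices: `m` from the modulus of continuity of `f`, then `n` from `m`, `δ` from `n`,
  -- and the number `2 l + 1` of traversals from `δ`. The threshold for `n` comes from `log n! - n
  -- log (m + 1) - log 2 ≥ n log n - n (1 + log (m + 1) + log 2)`.
  obtain ⟨m, hm⟩ := exists_nat_one_div_lt (f.1.modulus_pos (h := hr))
  have hm0 : 0 < m + 1 := m.succ_pos
  have hlog : ∀ᶠ n : ℕ in atTop, 1 + Real.log ((m + 1 : ℕ) : ℝ) + Real.log 2 < ε * Real.log n :=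
    ((Real.tendsto_log_atTop.comp tendsto_natCast_atTop_atTop).const_mul_atTop hε).eventually_gt_atTop _
  obtain ⟨n, hn, hnN, hn1⟩ := (hlog.and ((eventually_ge_atTop N).and (eventually_ge_atTop 1))).exists
  have hn1' : (1 : ℝ) ≤ n := by exact_mod_cast hn1
  have hf : (0 : ℝ) < n.factorial := by exact_mod_cast n.factorial_pos
  have hmpos : (0 : ℝ) < ((m + 1 : ℕ) : ℝ) := by positivity
  have hη : 0 < ((m + 1 : ℕ) : ℝ) ^ n / n.factorial := by positivity
  obtain ⟨δ, hδ, hclose⟩ := exists_volume_closeEvent_lt n (ENNReal.ofReal_pos.2 hη)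
  obtain ⟨l, hl⟩ := exists_nat_one_div_lt hδ
  have hk : Odd (2 * l + 1) := ⟨l, rfl⟩
  set Z := comb (m + 1) (2 * l + 1) hm0 hk with hZ
  have hpres : MeasurePreserving (f.1 ∘ Z.map) volume volume := f.2.comp Z.measurePreserving_map
  refine ⟨⟨f.1.comp Z.map, hpres⟩, CLambda.dist_lt fun x => ?_, n, hnN, ?_⟩
  · refine f.1.dist_lt_of_dist_lt_modulus r hr (lt_of_le_of_lt ?_ hm)
    have := abs_comb_sub_le (m + 1) (2 * l + 1) hm0 hk x.2
    push_cast at this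
    exact this
  · have hB : ∀ σ : Equiv.Perm (Fin n), (graphPermuton _ hpres).density σ ≤
        2 * (((m + 1 : ℕ) : ℝ) ^ n / n.factorial) :=
      density_comp_comb_le f hm0 hk (δ := δ) (by
        refine le_trans (one_div_le_one_div_of_le (by positivity) ?_) hl.le
        push_cast
        nlinarith [(Nat.cast_nonneg l : (0 : ℝ) ≤ l), (Nat.cast_nonneg m : (0 : ℝ) ≤ m),
          mul_nonneg (Nat.cast_nonneg l : (0 : ℝ) ≤ l) (Nat.cast_nonneg m : (0 : ℝ) ≤ m)])
        hclose.le hpres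
    have h := le_graphEntropy_of_density_le ⟨f.1.comp Z.map, hpres⟩ hB
    rw [Real.log_mul two_ne_zero hη.ne', Real.log_div (by positivity) hf.ne', Real.log_pow] at h
    have h2 := log_factorial_ge n
    have h3 := Real.log_pos (show (1 : ℝ) < 2 by norm_num)
    have h4 := mul_lt_mul_of_pos_left hn (show (0 : ℝ) < n by linarith)
    have h5 := mul_le_mul_of_nonneg_right hn1' h3.le
    nlinarith

/-! ### Entropy of piecewise increasing rearrangements of blocks -/

/-- Sublevel sets of a monotone map are initial segments, which their cardinalities determine. -/
theorem Monotone.eq_of_card_eq {n M : ℕ} {b b' : Fin n → Fin M} (hb : Monotone b)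
    (hb' : Monotone b')
    (h : ∀ j, (Finset.univ.filter fun i => b i ≤ j).card =
      (Finset.univ.filter fun i => b' i ≤ j).card) : b = b' := by
  have key : ∀ j, Finset.univ.filter (fun i => b i ≤ j) = Finset.univ.filter fun i => b' i ≤ j := by
    intro j
    have l : IsLowerSet {i | b i ≤ j} := fun _ _ h h' => (hb h).trans h'
    have l' : IsLowerSet {i | b' i ≤ j} := fun _ _ h h' => (hb' h).trans h'
    rcases l.total l' with hs | hs
    · exact Finset.eq_of_subset_of_card_le (Finset.monotone_filter_right _ fun i _ hi => hs hi)
        (h j).ge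
    · exact (Finset.eq_of_subset_of_card_le (Finset.monotone_filter_right _ fun i _ hi => hs hi)
        (h j).le).symm
  have key' : ∀ i j, b i ≤ j ↔ b' i ≤ j := fun i j => by
    simpa using congrArg (i ∈ ·) (key j)
  funext i
  exact le_antisymm ((key' i _).2 le_rfl) ((key' i _).1 le_rfl)

/-- If the restriction of `f` to `G` permutes `N + 1` consecutive blocks and is increasing on each
of them, then few patterns occur among points of `G`. -/
theorem card_patterns_le {f : unitInterval → unitInterval} {G : Set unitInterval} {N : ℕ}
    {b : unitInterval → Fin (N + 1)} {R : Fin (N + 1) → Fin (N + 1) → Prop} (hb : MonotoneOn b G)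
    (hR : ∀ x ∈ G, ∀ y ∈ G, f x < f y ↔ R (b x) (b y) ∨ (b x = b y ∧ x < y)) {n : ℕ}
    (S : Finset (Equiv.Perm (Fin n)))
    (hS : ∀ σ ∈ S, ∃ x : Fin n → unitInterval, (∀ i, x i ∈ G) ∧ x ∈ patternEvent f σ) :
    S.card ≤ (n + 1) ^ (N + 1) := by
  have h : ∀ σ ∈ S, ∃ β : Fin n → Fin (N + 1), Monotone β ∧
      ∀ i j, σ i < σ j ↔ R (β i) (β j) ∨ (β i = β j ∧ i < j) := by
    intro σ hσ
    obtain ⟨x, hx, hp⟩ := hS σ hσ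
    obtain ⟨τ, hτ, h⟩ := mem_patternEvent.1 hp
    refine ⟨fun i => b (x (τ i)), fun i j hij => hb (hx _) (hx _) (hτ.monotone hij), fun i j => ?_⟩
    rw [h, hR _ (hx _) _ (hx _)]
    have : x (τ i) < x (τ j) ↔ i < j := hτ.lt_iff_lt
    rw [this]
  choose! β hmono hβ using h
  have hle : ∀ (σ : Equiv.Perm (Fin n)) (j : Fin (N + 1)),
      (Finset.univ.filter fun i => β σ i ≤ j).card < n + 1 := fun σ j =>
    Nat.lt_succ_of_le ((Finset.card_le_univ _).trans (Fintype.card_fin n).le)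
  -- A pattern is encoded by the cumulative counts of its points in the blocks: `N + 1` numbers,
  -- each at most `n`.
  have := Finset.card_le_card_of_injOn (t := Finset.univ)
    (fun σ => fun j : Fin (N + 1) =>
      (⟨(Finset.univ.filter fun i => β σ i ≤ j).card, hle σ j⟩ : Fin (n + 1)))
    (s := S) (fun _ _ => Finset.mem_coe.2 (Finset.mem_univ _)) (by
      intro σ hσ σ' hσ' heq
      have e : β σ = β σ' := (hmono σ hσ).eq_of_card_eq (hmono σ' hσ') fun j =>
        congrArg Fin.val (congrFun heq j)
      refine perm_eq_of_lt_iff fun i j => ?_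
      rw [hβ σ hσ, hβ σ' hσ', e])
  simpa using this

/-- A pattern not realised inside `G` forces some sample point outside `G`, which has probability at
most `n δ` by the union bound. -/
theorem graphEntropy_le_of_blocks (f : CLambda) {G : Set unitInterval} {N : ℕ}
    {b : unitInterval → Fin (N + 1)} {R : Fin (N + 1) → Fin (N + 1) → Prop} (hb : MonotoneOn b G)
    (hR : ∀ x ∈ G, ∀ y ∈ G, f.1 x < f.1 y ↔ R (b x) (b y) ∨ (b x = b y ∧ x < y))
    (hG : MeasurableSet G) {δ : ℝ} (hδ : volume.real Gᶜ ≤ δ) (n : ℕ) :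
    graphEntropy f n ≤
      (N + 1) * Real.log (n + 1) + n * δ * Real.log (n.factorial) + 2 := by
  classical
  set S := Finset.univ.filter fun σ : Equiv.Perm (Fin n) =>
    ∃ x : Fin n → unitInterval, (∀ i, x i ∈ G) ∧ x ∈ patternEvent f.1 σ with hS
  have hcard : (S.card : ℝ) ≤ ((n : ℝ) + 1) ^ (N + 1) := by
    exact_mod_cast card_patterns_le hb hR S fun σ hσ => (Finset.mem_filter.1 hσ).2
  have hrest : ∑ σ ∈ Sᶜ, (graphPermuton f.1 f.2).density σ ≤ n * δ := by
    simp only [density_graphPermuton]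
    have h1 := sum_measureReal_le_of_disjoint_cover volume Sᶜ
      (fun σ : Equiv.Perm (Fin n) => patternEvent f.1 σ)
      (fun σ => measurableSet_patternEvent f.2.measurable σ) (disjoint_patternEvent f.1 n)
      (B := ⋃ i : Fin n, (fun x : Fin n → unitInterval => x i) ⁻¹' Gᶜ) (by
        intro σ hσ x hx
        by_contra hcon
        simp only [Set.mem_iUnion, Set.mem_preimage, Set.mem_compl_iff, not_exists, not_not] at hcon
        exact Finset.mem_compl.1 hσ (Finset.mem_filter.2 ⟨Finset.mem_univ _, x, hcon, hx⟩))
    refine h1.trans ((measureReal_iUnion_fintype_le _).trans ?_)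
    have h2 : ∀ i : Fin n, (volume : Measure (Fin n → unitInterval)).real
        ((fun x => x i) ⁻¹' Gᶜ) = volume.real Gᶜ := fun i =>
      (measurePreserving_eval (fun _ : Fin n => (volume : Measure unitInterval))
        i).measureReal_preimage hG.compl.nullMeasurableSet
    simp only [h2, Finset.sum_const, Finset.card_univ, Fintype.card_fin, nsmul_eq_mul]
    gcongr
  have hn : (1 : ℝ) ≤ (n : ℝ) + 1 := by simp
  have := graphEntropy_le_of_concentrated f S (one_le_pow₀ hn) hcard hrest
  rw [Real.log_pow] at this
  push_cast at this
  exact this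

/-! ### Rearrangements of blocks joined by fast transits -/

/-- The `k`-th turning point, in units of a block length, of the path that runs through the blocks
`p 0, p 1, …` in that order. -/
def shuffleTurn (p : ℕ → ℕ) (k : ℕ) : ℕ := p (k / 2) + k % 2

theorem shuffleTurn_even (p : ℕ → ℕ) (i : ℕ) : shuffleTurn p (2 * i) = p i := by
  rw [shuffleTurn, Nat.mul_div_cancel_left _ two_pos, Nat.mul_mod_right, add_zero]

theorem shuffleTurn_odd (p : ℕ → ℕ) (i : ℕ) : shuffleTurn p (2 * i + 1) = p i + 1 := by
  rw [shuffleTurn, show (2 * i + 1) / 2 = i by omega, show (2 * i + 1) % 2 = 1 by omega]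

theorem shuffleTurn_even_succ (p : ℕ → ℕ) (i : ℕ) :
    shuffleTurn p (2 * i + 1 + 1) = p (i + 1) :=
  shuffleTurn_even p (i + 1)

/-- The number of transits between consecutive blocks that cross the block `j`. -/
def transitCount (p : ℕ → ℕ) (N j : ℕ) : ℕ :=
  ((Finset.range N).filter fun i =>
    min (p i + 1) (p (i + 1)) ≤ j ∧ j < max (p i + 1) (p (i + 1))).card

theorem transitCount_le (p : ℕ → ℕ) (N j : ℕ) : transitCount p N j ≤ N :=
  (Finset.card_filter_le _ _).trans (Finset.card_range N).le

/-- The time per unit of length: `η` on the transits, and on the blocks the time that the transits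
leave. -/
noncomputable def shuffleCost (p : ℕ → ℕ) (N : ℕ) (η : ℝ) (k : ℕ) : ℝ :=
  if k % 2 = 0 then 1 - η * transitCount p N (p (k / 2)) else η

theorem shuffleCost_even (p : ℕ → ℕ) (N : ℕ) (η : ℝ) (i : ℕ) :
    shuffleCost p N η (2 * i) = 1 - η * transitCount p N (p i) := by
  rw [shuffleCost, Nat.mul_div_cancel_left _ two_pos, if_pos (Nat.mul_mod_right _ _)]

theorem shuffleCost_odd (p : ℕ → ℕ) (N : ℕ) (η : ℝ) (i : ℕ) :
    shuffleCost p N η (2 * i + 1) = η := by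
  rw [shuffleCost, if_neg (by omega)]

theorem sum_range_two_mul_add_one (g : ℕ → ℝ) (N : ℕ) :
    ∑ k ∈ Finset.range (2 * N + 1), g k =
      ∑ i ∈ Finset.range (N + 1), g (2 * i) + ∑ i ∈ Finset.range N, g (2 * i + 1) := by
  induction N with
  | zero => simp
  | succ N ih =>
    rw [show 2 * (N + 1) + 1 = 2 * N + 1 + 1 + 1 by ring, Finset.sum_range_succ,
      Finset.sum_range_succ, ih, Finset.sum_range_succ (fun i => g (2 * i)) (N + 1),
      Finset.sum_range_succ (fun i => g (2 * i + 1)) N,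
      show 2 * (N + 1) = 2 * N + 1 + 1 by ring]
    ring

theorem mem_uIoc_div_iff {m : ℕ} {y : ℝ} {j : ℕ} (hj : ∀ i : ℕ, (i : ℝ) / m < y ↔ i ≤ j)
    (p q : ℕ) :
    y ∈ Set.uIoc ((p : ℝ) / m) ((q : ℝ) / m) ↔ min p q ≤ j ∧ j < max p q := by
  rcases le_total p q with h | h
  · rw [Set.uIoc_of_le (by gcongr), mem_Ioc_div_iff hj, min_eq_left h, max_eq_right h]
  · rw [Set.uIoc_of_ge (by gcongr), mem_Ioc_div_iff hj, min_eq_right h, max_eq_left h]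

theorem small_transit {N : ℕ} {η : ℝ} (hη : 0 < η) (hη' : (2 * N + 1) * η ≤ 1 / (N + 1)) :
    N * η < 1 := by
  have h1 : 1 / ((N : ℝ) + 1) ≤ 1 := (div_le_one (by positivity)).2 (by simp)
  nlinarith [mul_nonneg (Nat.cast_nonneg N : (0 : ℝ) ≤ N) hη.le]

theorem transitCount_mul_le {p : ℕ → ℕ} {N : ℕ} {η : ℝ} (hη : 0 < η) (j : ℕ) :
    η * transitCount p N j ≤ N * η := by
  rw [mul_comm]
  gcongr
  exact transitCount_le p N j

/-- The path that runs through the `N + 1` blocks in the order `p 0, p 1, …, p N`, with fast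
transits from each block to the next. -/
noncomputable def shuffle (N : ℕ) (p : ℕ → ℕ)
    (hp : Set.BijOn p (Set.Iio (N + 1)) (Set.Iio (N + 1))) (η : ℝ) (hη : 0 < η)
    (hη' : (2 * N + 1) * η ≤ 1 / (N + 1)) : Zigzag where
  L := 2 * N + 1
  a k := shuffleTurn p k / (N + 1 : ℕ)
  c := shuffleCost p N η
  mem k hk := by
    refine ⟨by positivity, (div_le_one (by positivity)).2 ?_⟩
    have h : p (k / 2) < N + 1 := hp.mapsTo (show k / 2 < N + 1 by omega)
    have : shuffleTurn p k ≤ N + 1 := by rw [shuffleTurn]; omega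
    exact_mod_cast this
  c_pos k _ := by
    rcases k.even_or_odd' with ⟨i, rfl | rfl⟩
    · rw [shuffleCost_even]
      linarith [small_transit hη hη', transitCount_mul_le (p := p) (N := N) hη (p i)]
    · rwa [shuffleCost_odd]
  cover y hy := by
    classical
    obtain ⟨j, hjN, hj⟩ := exists_block N.succ_pos hy
    rw [sum_range_two_mul_add_one]
    obtain ⟨i₀, hi₀, rfl⟩ := hp.surjOn hjN
    have h1 : ∀ i ∈ Finset.range (N + 1),
        (Set.uIoc ((shuffleTurn p (2 * i) : ℝ) / (N + 1 : ℕ))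
          ((shuffleTurn p (2 * i + 1) : ℝ) / (N + 1 : ℕ))).indicator
          (fun _ => shuffleCost p N η (2 * i)) y =
        if i = i₀ then 1 - η * transitCount p N (p i₀) else 0 := by
      intro i hi
      rw [shuffleTurn_even, shuffleTurn_odd, shuffleCost_even, Set.indicator_apply]
      have : y ∈ Set.uIoc ((p i : ℝ) / (N + 1 : ℕ)) (((p i + 1 : ℕ) : ℝ) / (N + 1 : ℕ)) ↔
          i = i₀ := by
        rw [mem_uIoc_div_iff hj]
        constructor
        · intro h
          exact hp.injOn (Finset.mem_range.1 hi) hi₀ (by omega)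
        · rintro rfl
          omega
      by_cases h : i = i₀
      · rw [if_pos (this.2 h), if_pos h, h]
      · rw [if_neg (mt this.1 h), if_neg h]
    have h2 : ∀ i ∈ Finset.range N,
        (Set.uIoc ((shuffleTurn p (2 * i + 1) : ℝ) / (N + 1 : ℕ))
          ((shuffleTurn p (2 * i + 1 + 1) : ℝ) / (N + 1 : ℕ))).indicator
          (fun _ => shuffleCost p N η (2 * i + 1)) y =
        if min (p i + 1) (p (i + 1)) ≤ p i₀ ∧ p i₀ < max (p i + 1) (p (i + 1))
          then η else 0 := by
      intro i _
      rw [shuffleTurn_odd, shuffleTurn_even_succ, shuffleCost_odd, Set.indicator_apply]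
      exact if_congr (mem_uIoc_div_iff hj _ _) rfl rfl
    -- The unique block piece over `y` has cost `1 - η * transitCount`, and the transits over `y`
    -- add back exactly `η * transitCount`.
    rw [Finset.sum_congr rfl h1, Finset.sum_congr rfl h2, Finset.sum_ite_eq',
      if_pos (Finset.mem_range.2 hi₀), ← Finset.sum_filter, Finset.sum_const, nsmul_eq_mul,
      ← transitCount]
    ring

section

variable {N : ℕ} {p : ℕ → ℕ} {hp : Set.BijOn p (Set.Iio (N + 1)) (Set.Iio (N + 1))} {η : ℝ}
  {hη : 0 < η} {hη' : (2 * N + 1) * η ≤ 1 / (N + 1)}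

theorem shuffle_t_even (i : ℕ) :
    (shuffle N p hp η hη hη').t (2 * i + 1) = (shuffle N p hp η hη hη').t (2 * i) +
      (1 - η * transitCount p N (p i)) / (N + 1) := by
  rw [Zigzag.t_succ]
  change _ + shuffleCost p N η (2 * i) * |((shuffleTurn p (2 * i + 1) : ℕ) : ℝ) / (N + 1 : ℕ) -
    ((shuffleTurn p (2 * i) : ℕ) : ℝ) / (N + 1 : ℕ)| = _
  rw [shuffleCost_even, shuffleTurn_even, shuffleTurn_odd, ← sub_div]
  push_cast
  rw [add_sub_cancel_left, abs_of_pos (by positivity), mul_one_div]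

theorem shuffle_t_odd_le {i : ℕ} (hi : i < N) :
    (shuffle N p hp η hη hη').t (2 * i + 1 + 1) ≤ (shuffle N p hp η hη hη').t (2 * i + 1) + η := by
  rw [Zigzag.t_succ]
  have hL : (shuffle N p hp η hη hη').L = 2 * N + 1 := rfl
  have h1 := (shuffle N p hp η hη hη').mem (2 * i + 1) (by omega)
  have h2 := (shuffle N p hp η hη hη').mem (2 * i + 1 + 1) (by omega)
  have hc : (shuffle N p hp η hη hη').c (2 * i + 1) = η := shuffleCost_odd p N η i
  rw [hc]
  have : |(shuffle N p hp η hη hη').a (2 * i + 1 + 1) - (shuffle N p hp η hη hη').a (2 * i + 1)| ≤ 1 :=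
    abs_le.2 ⟨by linarith [h1.2, h2.1], by linarith [h1.1, h2.2]⟩
  have := mul_le_mul_of_nonneg_left this hη.le
  linarith

/-- Without transits the `k`-th turning time would be `⌈k / 2⌉ / (N + 1)`. Each step adds a drift of
at most `η`: a block is shortened by at most `N η / (N + 1)`, and a transit lasts at most `η`. The
hypothesis `hη'` keeps the whole drift below one block length. -/
theorem abs_shuffle_t_sub_le {k : ℕ} (hk : k ≤ 2 * N + 1) :
    |(shuffle N p hp η hη hη').t k - ((k + 1) / 2 : ℕ) / (N + 1)| ≤ k * η := by
  induction k with
  | zero => simp [Zigzag.t_zero]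
  | succ k ih =>
    have ih := abs_le.1 (ih (by omega))
    have hL : (shuffle N p hp η hη hη').L = 2 * N + 1 := rfl
    rcases k.even_or_odd' with ⟨i, rfl | rfl⟩
    · rw [shuffle_t_even]
      rw [show (2 * i + 1) / 2 = i by omega] at ih
      rw [show (2 * i + 1 + 1) / 2 = i + 1 by omega]
      have h1 : (0 : ℝ) < N + 1 := by positivity
      have h2 : η * transitCount p N (p i) / (N + 1) ≤ η := by
        rw [div_le_iff₀ h1]
        linarith [transitCount_mul_le (p := p) (N := N) hη (p i)]
      have h3 : 0 ≤ η * transitCount p N (p i) / (N + 1) := by positivity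
      have e : ((i + 1 : ℕ) : ℝ) / (N + 1) = i / (N + 1) + 1 / (N + 1) := by push_cast; ring
      rw [e, sub_div]
      push_cast at ih ⊢
      exact abs_le.2 ⟨by linarith [ih.1], by linarith [ih.2]⟩
    · have h1 := shuffle_t_odd_le (p := p) (hp := hp) (hη := hη) (hη' := hη')
        (show i < N by omega)
      have h2 := (shuffle N p hp η hη hη').t_le_succ (k := 2 * i + 1) (by omega)
      rw [show (2 * i + 1 + 1) / 2 = i + 1 by omega] at ih
      rw [show (2 * i + 1 + 1 + 1) / 2 = i + 1 by omega]
      push_cast at ih ⊢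
      exact abs_le.2 ⟨by linarith [ih.1], by linarith [ih.2]⟩

theorem shuffle_piece_bounds {k : ℕ} (hk : k < 2 * N + 1) {x : ℝ}
    (h1 : (shuffle N p hp η hη hη').t k ≤ x) (h2 : x ≤ (shuffle N p hp η hη hη').t (k + 1)) :
    (((k + 1) / 2 : ℕ) - 1 : ℝ) / (N + 1) ≤ x ∧ x ≤ (((k + 2) / 2 : ℕ) + 1 : ℝ) / (N + 1) := by
  have hb : ∀ l : ℕ, l ≤ 2 * N + 1 → (l : ℝ) * η ≤ 1 / (N + 1) := by
    intro l hl
    refine le_trans ?_ hη'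
    gcongr
    exact_mod_cast hl
  have e1 := abs_le.1 ((abs_shuffle_t_sub_le (hη' := hη') (hη := hη) (hp := hp) hk.le).trans
    (hb k hk.le))
  have e2 := abs_le.1 ((abs_shuffle_t_sub_le (hη' := hη') (hη := hη) (hp := hp)
    (show k + 1 ≤ 2 * N + 1 by omega)).trans (hb _ hk))
  rw [sub_div, add_div]
  exact ⟨by linarith [e1.1], by linarith [e2.2]⟩

theorem abs_shuffle_map_sub_le (f : unitInterval → unitInterval) {ρ ε : ℝ}
    (hf : ∀ x y : unitInterval, |(x : ℝ) - y| ≤ ρ → |(f x : ℝ) - f y| ≤ ε) (hρ : 3 / ((N : ℝ) + 1) ≤ ρ)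
    (hfp : ∀ i < N + 1, ∃ x : unitInterval,
      (x : ℝ) ∈ Set.Icc ((i : ℝ) / (N + 1)) ((i + 1) / (N + 1)) ∧
      (f x : ℝ) ∈ Set.Icc ((p i : ℝ) / (N + 1)) ((p i + 1) / (N + 1))) (x : unitInterval) :
    |((shuffle N p hp η hη hη').map x : ℝ) - f x| ≤ 1 / (N + 1) + ε := by
  rw [Zigzag.coe_map]
  have hN : (0 : ℝ) < 1 / ((N : ℝ) + 1) := by positivity
  have h3 : 3 / ((N : ℝ) + 1) = 3 * (1 / (N + 1)) := by ring
  -- The witness `y` from `hfp` lies in block `l / 2`, hence within three block lengths of `x`. The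
  -- turning point and `f y` share the closed block `p (l / 2)`.
  have main : ∀ l ≤ 2 * N + 1, ((l / 2 : ℕ) : ℝ) / (N + 1) ≤ x + 2 * (1 / (N + 1)) →
      (x : ℝ) ≤ ((l / 2 : ℕ) : ℝ) / (N + 1) + 2 * (1 / (N + 1)) →
      |((shuffleTurn p l : ℕ) : ℝ) / (N + 1 : ℕ) - f x| ≤ 1 / (N + 1) + ε := by
    intro l hl hl1 hl2
    obtain ⟨y, hy, hfy⟩ := hfp (l / 2) (by omega)
    rw [Set.mem_Icc, add_div] at hy hfy
    have h4 := abs_le.1 (hf y x (abs_le.2 ⟨by linarith [hy.1], by linarith [hy.2]⟩))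
    have h5 : ((p (l / 2) : ℕ) : ℝ) / (N + 1) ≤ ((shuffleTurn p l : ℕ) : ℝ) / (N + 1 : ℕ) := by
      push_cast
      gcongr
      exact Nat.le_add_right _ _
    have h6 : ((shuffleTurn p l : ℕ) : ℝ) / (N + 1 : ℕ) ≤
        ((p (l / 2) : ℕ) : ℝ) / (N + 1) + 1 / (N + 1) := by
      rw [← add_div]
      push_cast
      gcongr
      have : shuffleTurn p l ≤ p (l / 2) + 1 := by rw [shuffleTurn]; omega
      exact_mod_cast this
    exact abs_le.2 ⟨by linarith [h4.1, hfy.2], by linarith [h4.2, hfy.1]⟩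
  refine Zigzag.abs_toFun_sub_le _ x.2 fun k (hk : k < 2 * N + 1) h1 h2 => ?_
  obtain ⟨hlo, hhi⟩ := shuffle_piece_bounds hk h1 h2
  rw [sub_div] at hlo
  rw [add_div] at hhi
  have g1 : (((k + 1) / 2 : ℕ) : ℝ) ≤ ((k / 2 : ℕ) : ℝ) + 1 := by
    exact_mod_cast (by omega : (k + 1) / 2 ≤ k / 2 + 1)
  have g2 : ((k / 2 : ℕ) : ℝ) ≤ (((k + 1) / 2 : ℕ) : ℝ) := by
    exact_mod_cast (by omega : k / 2 ≤ (k + 1) / 2)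
  have g3 : (((k + 2) / 2 : ℕ) : ℝ) = ((k / 2 : ℕ) : ℝ) + 1 := by
    exact_mod_cast (by omega : (k + 2) / 2 = k / 2 + 1)
  have hpos : (0 : ℝ) ≤ N + 1 := by positivity
  have d1 := div_le_div_of_nonneg_right g1 hpos
  have d2 := div_le_div_of_nonneg_right g2 hpos
  rw [add_div] at d1
  rw [g3, add_div] at hhi
  exact ⟨main k hk.le (by linarith) (by linarith), main (k + 1) hk (by linarith) (by linarith)⟩

end

/-! ### Maps of low entropy are dense -/

theorem Zigzag.volume_piece_le (Z : Zigzag) (k : ℕ) :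
    volume (Z.piece k) ≤ ENNReal.ofReal (Z.t (k + 1) - Z.t k) := by
  rw [unitInterval.volume_apply, ← Real.volume_Ioc]
  refine measure_mono ?_
  rintro _ ⟨x, hx, rfl⟩
  exact hx

theorem Zigzag.index_le_of_le (Z : Zigzag) {x y : unitInterval} {k l : ℕ} (hx : x ∈ Z.piece k)
    (hy : y ∈ Z.piece l) (hk : k < Z.L) (hxy : x ≤ y) : k ≤ l := by
  by_contra h
  have h1 := Z.t_mono (show l + 1 ≤ k by omega) hk.le
  have h2 : Z.t k < x := hx.1
  have h3 : (y : ℝ) ≤ Z.t (l + 1) := hy.2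
  have h4 : (x : ℝ) ≤ y := hxy
  linarith

section

variable {N : ℕ} {p : ℕ → ℕ} {hp : Set.BijOn p (Set.Iio (N + 1)) (Set.Iio (N + 1))} {η : ℝ}
  {hη : 0 < η} {hη' : (2 * N + 1) * η ≤ 1 / (N + 1)}

theorem shuffle_t_even_lt (i : ℕ) :
    (shuffle N p hp η hη hη').t (2 * i) < (shuffle N p hp η hη hη').t (2 * i + 1) := by
  have h := small_transit hη hη'
  have h1 := transitCount_mul_le (p := p) (N := N) hη (p i)
  have : 0 < (1 - η * transitCount p N (p i)) / (N + 1) := div_pos (by linarith) (by positivity)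
  rw [shuffle_t_even]
  linarith

theorem shuffle_toFun_eq {i : ℕ} (hi : i < N + 1) {x : unitInterval}
    (hx : x ∈ (shuffle N p hp η hη hη').piece (2 * i)) :
    (shuffle N p hp η hη hη').toFun x = (p i : ℝ) / (N + 1) + 1 / (N + 1) *
      ((x - (shuffle N p hp η hη hη').t (2 * i)) /
        ((shuffle N p hp η hη hη').t (2 * i + 1) - (shuffle N p hp η hη hη').t (2 * i))) := by
  have hL : (shuffle N p hp η hη hη').L = 2 * N + 1 := rfl
  rw [(shuffle N p hp η hη hη').toFun_eq (by omega) hx.1.le hx.2]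
  change ((shuffleTurn p (2 * i) : ℕ) : ℝ) / (N + 1 : ℕ) +
    (((shuffleTurn p (2 * i + 1) : ℕ) : ℝ) / (N + 1 : ℕ) -
      ((shuffleTurn p (2 * i) : ℕ) : ℝ) / (N + 1 : ℕ)) * _ = _
  rw [shuffleTurn_even, shuffleTurn_odd, ← sub_div]
  push_cast
  rw [add_sub_cancel_left]

theorem shuffle_toFun_mem {i : ℕ} (hi : i < N + 1) {x : unitInterval}
    (hx : x ∈ (shuffle N p hp η hη hη').piece (2 * i)) :
    (shuffle N p hp η hη hη').toFun x ∈
      Set.Ioc ((p i : ℝ) / (N + 1)) (((p i : ℝ) + 1) / (N + 1)) := by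
  have h1 := shuffle_t_even_lt (hp := hp) (hη := hη) (hη' := hη') i
  have h2 := hx.1
  have h3 := hx.2
  rw [shuffle_toFun_eq hi hx, add_div]
  constructor
  · have := mul_pos (show (0 : ℝ) < 1 / (N + 1) by positivity)
      (div_pos (sub_pos.2 h2) (sub_pos.2 h1))
    linarith
  · have := mul_le_of_le_one_right (show (0 : ℝ) ≤ 1 / (N + 1) by positivity)
      (div_le_one_of_le₀ (sub_le_sub_right h3 ((shuffle N p hp η hη hη').t (2 * i)))
        (sub_pos.2 h1).le)
    linarith

theorem shuffle_map_lt_iff {i j : ℕ} (hi : i < N + 1) (hj : j < N + 1) {x y : unitInterval}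
    (hx : x ∈ (shuffle N p hp η hη hη').piece (2 * i))
    (hy : y ∈ (shuffle N p hp η hη hη').piece (2 * j)) :
    (shuffle N p hp η hη hη').map x < (shuffle N p hp η hη hη').map y ↔
      p i < p j ∨ (i = j ∧ x < y) := by
  rw [← Subtype.coe_lt_coe, Zigzag.coe_map, Zigzag.coe_map]
  have hN : (0 : ℝ) < N + 1 := by positivity
  have key : ∀ {i j : ℕ} {x y : unitInterval}, i < N + 1 → j < N + 1 →
      x ∈ (shuffle N p hp η hη hη').piece (2 * i) → y ∈ (shuffle N p hp η hη hη').piece (2 * j) →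
      p i < p j → (shuffle N p hp η hη hη').toFun x < (shuffle N p hp η hη hη').toFun y := by
    intro i j x y hi hj hx hy h
    have h1 : ((p i : ℝ) + 1) / (N + 1) ≤ (p j : ℝ) / (N + 1) := by
      gcongr
      exact_mod_cast h
    exact (shuffle_toFun_mem hi hx).2.trans_lt (h1.trans_lt (shuffle_toFun_mem hj hy).1)
  by_cases hij : i = j
  · subst hij
    have h1 := sub_pos.2 (shuffle_t_even_lt (hp := hp) (hη := hη) (hη' := hη') i)
    rw [shuffle_toFun_eq hi hx, shuffle_toFun_eq hi hy, add_lt_add_iff_left,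
      mul_lt_mul_iff_right₀ (by positivity), div_lt_div_iff_of_pos_right h1, sub_lt_sub_iff_right]
    simp
  · rcases lt_trichotomy (p i) (p j) with h | h | h
    · exact iff_of_true (key hi hj hx hy h) (Or.inl h)
    · exact absurd (hp.injOn hi hj h) hij
    · exact iff_of_false (key hj hi hy hx h).not_gt (by rintro (h' | ⟨h', -⟩) <;> omega)

theorem volume_compl_even_pieces_le :
    volume.real (⋃ i : Fin (N + 1), (shuffle N p hp η hη hη').piece (2 * i))ᶜ ≤ N * η := by
  have hL : (shuffle N p hp η hη hη').L = 2 * N + 1 := rfl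
  have hsub : (⋃ i : Fin (N + 1), (shuffle N p hp η hη hη').piece (2 * i))ᶜ ⊆
      -- The point `0` belongs to no piece, since pieces are open on the left.
      {0} ∪ ⋃ i ∈ Finset.range N, (shuffle N p hp η hη hη').piece (2 * i + 1) := by
    intro x hx
    by_cases h0 : x = 0
    · exact Or.inl h0
    · right
      obtain ⟨k, hk, hxk⟩ := (shuffle N p hp η hη hη').exists_mem_piece h0
      rcases k.even_or_odd' with ⟨i, rfl | rfl⟩
      · exact absurd (Set.mem_iUnion.2 ⟨⟨i, by omega⟩, hxk⟩) hx
      · exact Set.mem_iUnion₂.2 ⟨i, Finset.mem_range.2 (by omega), hxk⟩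
  have h : volume (⋃ i : Fin (N + 1), (shuffle N p hp η hη hη').piece (2 * i))ᶜ ≤
      ENNReal.ofReal (N * η) := by
    refine (measure_mono hsub).trans ((measure_union_le _ _).trans ?_)
    rw [measure_singleton, zero_add]
    refine (measure_biUnion_finset_le _ _).trans ?_
    refine (Finset.sum_le_sum (g := fun _ => ENNReal.ofReal η) fun i hi =>
      ((shuffle N p hp η hη hη').volume_piece_le _).trans (ENNReal.ofReal_le_ofReal ?_)).trans ?_
    · linarith [shuffle_t_odd_le (p := p) (hp := hp) (hη := hη) (hη' := hη')
        (Finset.mem_range.1 hi)]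
    · rw [Finset.sum_const, Finset.card_range, nsmul_eq_mul, ENNReal.ofReal_mul (by positivity),
        ENNReal.ofReal_natCast]
  exact ENNReal.toReal_le_of_le_ofReal (by positivity) h

theorem graphEntropy_shuffle_le (n : ℕ) :
    graphEntropy ⟨(shuffle N p hp η hη hη').map, (shuffle N p hp η hη hη').measurePreserving_map⟩ n ≤
      (N + 1) * Real.log (n + 1) + n * (N * η) * Real.log (n.factorial) + 2 := by
  classical
  have hL : (shuffle N p hp η hη hη').L = 2 * N + 1 := rfl
  set Z := shuffle N p hp η hη hη' with hZ
  set G := ⋃ i : Fin (N + 1), Z.piece (2 * i) with hG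
  have hex : ∀ x : unitInterval, ∃ i : Fin (N + 1), x ∈ G → x ∈ Z.piece (2 * i) := by
    intro x
    by_cases h : x ∈ G
    · obtain ⟨i, hi⟩ := Set.mem_iUnion.1 h
      exact ⟨i, fun _ => hi⟩
    · exact ⟨0, fun h' => absurd h' h⟩
  choose b hb using hex
  refine graphEntropy_le_of_blocks _ (G := G) (b := b) (R := fun i j => p i < p j) ?_ ?_ ?_ ?_ n
  · intro x hx y hy hxy
    have := Z.index_le_of_le (hb x hx) (hb y hy) (by have := (b x).2; omega) hxy
    exact Fin.le_def.2 (by omega)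
  · intro x hx y hy
    rw [Fin.ext_iff]
    exact shuffle_map_lt_iff (b x).2 (b y).2 (hb x hx) (hb y hy)
  · exact .iUnion fun i => Z.measurableSet_piece _
  · exact volume_compl_even_pieces_le

end

/-- A measure-preserving map is matched by a permutation of equal blocks. -/
theorem exists_block_bijOn {f : unitInterval → unitInterval}
    (hf : MeasurePreserving f volume volume) (N : ℕ) :
    ∃ p : ℕ → ℕ, Set.BijOn p (Set.Iio (N + 1)) (Set.Iio (N + 1)) ∧
      ∀ i < N + 1, ∃ x : unitInterval,
        (x : ℝ) ∈ Set.Icc ((i : ℝ) / (N + 1)) ((i + 1) / (N + 1)) ∧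
        (f x : ℝ) ∈ Set.Icc ((p i : ℝ) / (N + 1)) ((p i + 1) / (N + 1)) := by
  classical
  have hN : (0 : ℝ) < N + 1 := by positivity
  -- Two versions of the blocks: the half-open `I` are disjoint, the closed `J` cover the interval
  -- including `0`. Both have measure `1 / (N + 1)`.
  set I : ℕ → Set unitInterval := fun i =>
    ((↑) : unitInterval → ℝ) ⁻¹' Set.Ioc ((i : ℝ) / (N + 1)) ((i + 1) / (N + 1)) with hI
  set J : ℕ → Set unitInterval := fun i =>
    ((↑) : unitInterval → ℝ) ⁻¹' Set.Icc ((i : ℝ) / (N + 1)) ((i + 1) / (N + 1)) with hJ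
  have hmem : ∀ i ≤ N + 1, (i : ℝ) / (N + 1) ∈ Set.Icc (0 : ℝ) 1 := fun i hi =>
    ⟨by positivity, (div_le_one hN).2 (by exact_mod_cast hi)⟩
  have hmem' : ∀ i < N + 1, ((i : ℝ) + 1) / (N + 1) ∈ Set.Icc (0 : ℝ) 1 := fun i hi => by
    exact_mod_cast hmem (i + 1) hi
  have hdiff : ∀ i : ℕ, ((i : ℝ) + 1) / (N + 1) - i / (N + 1) = 1 / (N + 1) := fun i => by ring
  have hIv : ∀ i < N + 1, volume (I i) = ENNReal.ofReal (1 / (N + 1)) := fun i hi => by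
    have := unitInterval.volume_Ioc (⟨_, hmem i hi.le⟩ : unitInterval) ⟨_, hmem' i hi⟩
    exact this.trans (congrArg ENNReal.ofReal (hdiff i))
  have hJv : ∀ i < N + 1, volume (J i) = ENNReal.ofReal (1 / (N + 1)) := fun i hi => by
    have := unitInterval.volume_Icc (⟨_, hmem i hi.le⟩ : unitInterval) ⟨_, hmem' i hi⟩
    exact this.trans (congrArg ENNReal.ofReal (hdiff i))
  have hcoverJ : ∀ y : unitInterval, ∃ j < N + 1, y ∈ J j := by
    intro y
    rcases y.2.1.eq_or_lt with h0 | h0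
    · refine ⟨0, N.succ_pos, ?_⟩
      change (y : ℝ) ∈ Set.Icc _ _
      rw [← h0]
      constructor
      · simp
      · positivity
    · obtain ⟨j, hj, h⟩ := exists_block N.succ_pos ⟨h0, y.2.2⟩
      refine ⟨j, hj, ?_⟩
      have h1 := (h j).2 le_rfl
      have h2 := not_lt.1 (mt (h (j + 1)).1 (by omega))
      push_cast at h1 h2
      exact ⟨h1.le, h2⟩
  set T : Fin (N + 1) → Finset (Fin (N + 1)) := fun i =>
    Finset.univ.filter fun j => ∃ x ∈ J i, f x ∈ J j with hT
  -- Hall's condition is a comparison of measures: the blocks of `s` lie in the preimage of the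
  -- blocks that they meet, and `f` preserves measure.
  have hHall : ∀ s : Finset (Fin (N + 1)), s.card ≤ (s.biUnion T).card := by
    intro s
    have hdisj : Set.PairwiseDisjoint (s : Set (Fin (N + 1))) fun i => I i := by
      intro i _ j _ hij
      have key : ∀ i j : ℕ, i < j → ∀ x : unitInterval, x ∈ I i → x ∉ I j := by
        intro i j hij x hx hx'
        have h1 : (x : ℝ) ≤ ((i : ℝ) + 1) / (N + 1) := hx.2
        have h2 : (j : ℝ) / (N + 1) < x := hx'.1
        have h3 : ((i : ℝ) + 1) / (N + 1) ≤ (j : ℝ) / (N + 1) := by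
          gcongr
          exact_mod_cast hij
        linarith
      rcases lt_or_gt_of_ne (Fin.val_ne_of_ne hij) with h | h
      · exact Set.disjoint_left.2 (key _ _ h)
      · exact (Set.disjoint_left.2 (key _ _ h)).symm
    have hle : volume (⋃ i ∈ s, I i) ≤ volume (f ⁻¹' ⋃ j ∈ s.biUnion T, J j) := by
      refine measure_mono fun x hx => ?_
      obtain ⟨i, hi, hxi⟩ := Set.mem_iUnion₂.1 hx
      obtain ⟨j, hj, hfj⟩ := hcoverJ (f x)
      refine Set.mem_iUnion₂.2 ⟨⟨j, hj⟩, Finset.mem_biUnion.2 ⟨i, hi, ?_⟩, hfj⟩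
      exact Finset.mem_filter.2 ⟨Finset.mem_univ _, x, ⟨hxi.1.le, hxi.2⟩, hfj⟩
    have hmeasI : ∀ i, MeasurableSet (I i) := fun i => measurable_subtype_coe measurableSet_Ioc
    have hmeasJ : ∀ i, MeasurableSet (J i) := fun i => measurable_subtype_coe measurableSet_Icc
    rw [hf.measure_preimage
      (Finset.measurableSet_biUnion _ fun (j : Fin (N + 1)) _ => hmeasJ j).nullMeasurableSet,
      measure_biUnion_finset hdisj fun i _ => hmeasI i] at hle
    have hle := hle.trans (measure_biUnion_finset_le _ _)
    rw [Finset.sum_congr rfl fun (i : Fin (N + 1)) _ => hIv i i.2,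
      Finset.sum_congr rfl fun (i : Fin (N + 1)) _ => hJv i i.2,
      Finset.sum_const, Finset.sum_const, nsmul_eq_mul, nsmul_eq_mul,
      ENNReal.mul_le_mul_iff_left (ENNReal.ofReal_pos.2 (by positivity)).ne' ENNReal.ofReal_ne_top]
      at hle
    exact_mod_cast hle
  obtain ⟨g, hg, hgT⟩ := (Finset.all_card_le_biUnion_card_iff_exists_injective T).1 hHall
  have hsurj := Finite.surjective_of_injective hg
  refine ⟨fun i => if h : i < N + 1 then g ⟨i, h⟩ else 0, ⟨?_, ?_, ?_⟩, ?_⟩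
  · intro i (hi : i < N + 1)
    simp only [dif_pos hi]
    exact (g ⟨i, hi⟩).2
  · intro i (hi : i < N + 1) j (hj : j < N + 1) h
    simp only [dif_pos hi, dif_pos hj] at h
    exact Fin.mk.inj_iff.1 (hg (Fin.ext h))
  · intro j (hj : j < N + 1)
    obtain ⟨i, hi⟩ := hsurj ⟨j, hj⟩
    exact ⟨i, i.2, by simp only [dif_pos i.2, Fin.eta, hi]⟩
  · intro i hi
    obtain ⟨x, hx, hfx⟩ := (Finset.mem_filter.1 (hgT ⟨i, hi⟩)).2
    simp only [dif_pos hi]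
    exact ⟨x, hx, hfx⟩

theorem eventually_mul_log_succ_add_lt (C K : ℝ) {ε : ℝ} (hε : 0 < ε) :
    ∀ᶠ n : ℕ in atTop, C * Real.log ((n : ℝ) + 1) + K < ε * n := by
  have h1 : Tendsto (fun n : ℕ => Real.log ((n : ℝ) + 1) / ((n : ℝ) + 1)) atTop (𝓝 0) :=
    (Real.isLittleO_log_id_atTop.tendsto_div_nhds_zero).comp
      (tendsto_atTop_add_const_right _ 1 tendsto_natCast_atTop_atTop)
  have h2 : Tendsto (fun n : ℕ => (K + ε) * (1 / ((n : ℝ) + 1))) atTop (𝓝 0) := by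
    simpa using tendsto_one_div_add_atTop_nhds_zero_nat.const_mul (K + ε)
  have h3 := (h1.const_mul C).add h2
  rw [mul_zero, add_zero] at h3
  filter_upwards [h3.eventually_lt_const hε] with n hn
  have hn0 : (0 : ℝ) < (n : ℝ) + 1 := by positivity
  have : C * (Real.log ((n : ℝ) + 1) / ((n : ℝ) + 1)) + (K + ε) * (1 / ((n : ℝ) + 1)) =
      (C * Real.log ((n : ℝ) + 1) + (K + ε)) / ((n : ℝ) + 1) := by ring
  rw [this, div_lt_iff₀ hn0] at hn
  linarith

theorem exists_graphEntropy_lt (f : CLambda) {r ε : ℝ} (hr : 0 < r) (hε : 0 < ε) (K : ℕ) :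
    ∃ g : CLambda, dist g f < r ∧ ∃ n ≥ K, graphEntropy g n < ε * n := by
  have hr2 : 0 < r / 2 := by positivity
  -- The `6` gives `3 / (N + 1)` below half the modulus, and the `4` gives `1 / (N + 1) + r / 2 <
  -- r`.
  obtain ⟨N, hN⟩ := exists_nat_one_div_lt (show 0 < min (f.1.modulus (r / 2) hr2 / 6) (r / 4) from
    lt_min (div_pos (f.1.modulus_pos (h := hr2)) (by norm_num)) (by positivity))
  obtain ⟨hN1, hN2⟩ := lt_min_iff.1 hN
  obtain ⟨p, hp, hfp⟩ := exists_block_bijOn f.2 N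
  -- The `3` is the constant `2` of the entropy bound plus `1` for samples that hit a transit.
  obtain ⟨n, hn, hnK⟩ := ((eventually_mul_log_succ_add_lt (N + 1) 3 hε).and
    (eventually_ge_atTop K)).exists
  have hlog : 0 ≤ Real.log (n.factorial) :=
    Real.log_nonneg (by exact_mod_cast n.factorial_pos)
  have hW : 0 ≤ (n : ℝ) * N * Real.log (n.factorial) := by positivity
  -- The transit cost is `1 / W`. The first summand of `W` ensures `hη'`, the second `hsmall`.
  set W : ℝ := (2 * N + 1) * (N + 1) + n * N * Real.log (n.factorial) with hWdef
  have hWpos : 0 < W := by positivity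
  have hη' : (2 * (N : ℝ) + 1) * (1 / W) ≤ 1 / (N + 1) := by
    rw [mul_one_div, div_le_div_iff₀ hWpos (by positivity)]
    linarith
  have hsmall : (n : ℝ) * (N * (1 / W)) * Real.log (n.factorial) ≤ 1 := by
    have : (n : ℝ) * (N * (1 / W)) * Real.log (n.factorial) =
      (n * N * Real.log (n.factorial)) / W := by ring
    rw [this, div_le_one hWpos]
    have : (0 : ℝ) ≤ (2 * N + 1) * (N + 1) := by positivity
    linarith
  set Z := shuffle N p hp (1 / W) (by positivity) hη' with hZ
  refine ⟨⟨Z.map, Z.measurePreserving_map⟩, CLambda.dist_lt fun x => ?_, n, hnK, ?_⟩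
  · have := abs_shuffle_map_sub_le (hp := hp) (hη := by positivity) (hη' := hη') f.1
      (ρ := f.1.modulus (r / 2) hr2 / 2) (ε := r / 2) (fun x y hxy =>
        (f.1.dist_lt_of_dist_lt_modulus (r / 2) hr2 (lt_of_le_of_lt hxy
          (half_lt_self (f.1.modulus_pos (h := hr2))))).le) (by
        have : 3 / ((N : ℝ) + 1) = 3 * (1 / (N + 1)) := by ring
        linarith) hfp x
    exact this.trans_lt (by linarith)
  · have := graphEntropy_shuffle_le (hp := hp) (hη := by positivity) (hη' := hη') n
    change graphEntropy ⟨Z.map, Z.measurePreserving_map⟩ n ≤ _ at this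
    linarith

/-! ### Generic behaviour -/

/-- Lying in infinitely many `V n` means lying in every `⋃ n ≥ N, V n`, a countable intersection of
dense open sets. -/
theorem residual_frequently {X : Type*} [TopologicalSpace X] {V : ℕ → Set X}
    (ho : ∀ n, IsOpen (V n)) (hd : ∀ N, Dense (⋃ n ≥ N, V n)) :
    ∀ᶠ x in residual X, ∃ᶠ n in atTop, x ∈ V n := by
  have h : ∀ N : ℕ, ∀ᶠ x in residual X, x ∈ ⋃ n ≥ N, V n := fun N =>
    residual_of_dense_open (isOpen_iUnion fun n => isOpen_iUnion fun _ => ho n) (hd N)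
  filter_upwards [eventually_countable_forall.2 h] with x hx
  refine frequently_atTop.2 fun N => ?_
  obtain ⟨n, hn, h⟩ := Set.mem_iUnion₂.1 (hx N)
  exact ⟨n, hn, h⟩

theorem residual_frequently_graphEntropy_lt {ε : ℝ} (hε : 0 < ε) :
    ∀ᶠ f in residual CLambda, ∃ᶠ n : ℕ in atTop, graphEntropy f n < ε * n := by
  refine residual_frequently (V := fun n : ℕ => {f : CLambda | graphEntropy f n < ε * n})
    (fun n => isOpen_lt (continuous_graphEntropy n) continuous_const) fun N => ?_
  refine Metric.dense_iff.2 fun f r hr => ?_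
  obtain ⟨g, hg, n, hn, h⟩ := exists_graphEntropy_lt f hr hε N
  exact ⟨g, hg, Set.mem_iUnion₂.2 ⟨n, hn, h⟩⟩

theorem residual_frequently_lt_graphEntropy {ε : ℝ} (hε : 0 < ε) :
    ∀ᶠ f in residual CLambda, ∃ᶠ n : ℕ in atTop,
      (1 - ε) * (n * Real.log n) < graphEntropy f n := by
  refine residual_frequently
    (V := fun n : ℕ => {f : CLambda | (1 - ε) * (n * Real.log n) < graphEntropy f n})
    (fun n => isOpen_lt continuous_const (continuous_graphEntropy n)) fun N => ?_
  refine Metric.dense_iff.2 fun f r hr => ?_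
  obtain ⟨g, hg, n, hn, h⟩ := exists_graphEntropy_gt f hr hε N
  exact ⟨g, hg, Set.mem_iUnion₂.2 ⟨n, hn, h⟩⟩

theorem graphEntropy_le_mul_log (f : CLambda) (n : ℕ) : graphEntropy f n ≤ n * Real.log n := by
  refine (graphEntropy_le_log_factorial f n).trans ?_
  rw [← Real.log_pow]
  refine Real.log_le_log (by exact_mod_cast n.factorial_pos) ?_
  exact_mod_cast n.factorial_le_pow

theorem liminf_graphEntropy_div {f : CLambda}
    (h : ∀ ε > 0, ∃ᶠ n : ℕ in atTop, graphEntropy f n < ε * n) :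
    liminf (fun n : ℕ => ((graphEntropy f n / (n : ℝ) : ℝ) : EReal)) atTop = 0 := by
  refine le_antisymm (not_lt.1 fun hlt => ?_) ?_
  · obtain ⟨ε, h0, h1⟩ := EReal.lt_iff_exists_real_btwn.1 hlt
    have hε : 0 < ε := EReal.coe_pos.1 h0
    refine h1.not_ge (liminf_le_of_frequently_le ((h ε hε).mono fun n hn => ?_))
    exact EReal.coe_le_coe_iff.2 (div_le_of_le_mul₀ n.cast_nonneg hε.le hn.le)
  · refine le_liminf_of_le (by isBoundedDefault) (Eventually.of_forall fun n => ?_)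
    exact EReal.coe_nonneg.2 (div_nonneg (graphEntropy_nonneg f n) n.cast_nonneg)

theorem limsup_graphEntropy_div {f : CLambda}
    (h : ∀ ε > 0, ∃ᶠ n : ℕ in atTop, (1 - ε) * (n * Real.log n) < graphEntropy f n) :
    limsup (fun n : ℕ => ((graphEntropy f n / ((n : ℝ) * Real.log n) : ℝ) : EReal)) atTop = 1 := by
  refine le_antisymm ?_ (not_lt.1 fun hlt => ?_)
  -- For `n ≤ 1` the denominator is `0` and the quotient is `0` by convention, so the bound holds
  -- for every `n`.
  · refine limsup_le_of_le (by isBoundedDefault) (Eventually.of_forall fun n => ?_)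
    exact EReal.coe_le_coe_iff.2 (div_le_one_of_le₀ (graphEntropy_le_mul_log f n)
      (mul_nonneg n.cast_nonneg (Real.log_natCast_nonneg n)))
  · obtain ⟨r, h0, h1⟩ := EReal.lt_iff_exists_real_btwn.1 hlt
    have hr : 0 < 1 - r := sub_pos.2 (EReal.coe_lt_coe_iff.1 h1)
    refine h0.not_ge (le_limsup_of_frequently_le
      (((h _ hr).and_eventually (eventually_ge_atTop 2)).mono fun n ⟨hn, hn2⟩ => ?_))
    have hn' : (1 : ℝ) < n := by exact_mod_cast hn2
    rw [sub_sub_cancel] at hn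
    exact EReal.coe_le_coe_iff.2
      ((le_div_iff₀ (mul_pos (by linarith) (Real.log_pos hn'))).2 hn.le)

/-- The generic `f ∈ C(λ)` has lower linear entropy `0` and upper superlinear entropy `1`; neither
`H_n(μ_f) / n` nor `H_n(μ_f) / (n log n)` has a limit, finite or infinite. -/
theorem theorem4 :
    ∀ᶠ f in residual CLambda,
      liminf (fun n : ℕ => ((graphEntropy f n / (n : ℝ) : ℝ) : EReal)) atTop = 0 ∧
      limsup (fun n : ℕ => ((graphEntropy f n / ((n : ℝ) * Real.log n) : ℝ) : EReal)) atTop = 1 ∧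
      (¬ ∃ l : EReal,
        Tendsto (fun n : ℕ => ((graphEntropy f n / (n : ℝ) : ℝ) : EReal)) atTop (𝓝 l)) ∧
      (¬ ∃ l : EReal,
        Tendsto (fun n : ℕ => ((graphEntropy f n / ((n : ℝ) * Real.log n) : ℝ) : EReal))
          atTop (𝓝 l)) := by
  have hpos : ∀ j : ℕ, (0 : ℝ) < 1 / (j + 1) := fun j => by positivity
  filter_upwards [eventually_countable_forall.2 fun j : ℕ =>
      residual_frequently_graphEntropy_lt (hpos j),
    eventually_countable_forall.2 fun j : ℕ =>
      residual_frequently_lt_graphEntropy (hpos j)] with f hlow hhigh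
  have hlow' : ∀ ε > 0, ∃ᶠ n : ℕ in atTop, graphEntropy f n < ε * n := by
    intro ε hε
    obtain ⟨j, hj⟩ := exists_nat_one_div_lt hε
    exact (hlow j).mono fun n hn => hn.trans_le (by gcongr)
  have hhigh' : ∀ ε > 0, ∃ᶠ n : ℕ in atTop,
      (1 - ε) * (n * Real.log n) < graphEntropy f n := by
    intro ε hε
    obtain ⟨j, hj⟩ := exists_nat_one_div_lt hε
    refine (hhigh j).mono fun n hn => lt_of_le_of_lt ?_ hn
    have := mul_nonneg n.cast_nonneg (Real.log_natCast_nonneg n)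
    gcongr
  have hinf := liminf_graphEntropy_div hlow'
  have hsup := limsup_graphEntropy_div hhigh'
  have hlog : ∀ᶠ n : ℕ in atTop, 2 < Real.log n :=
    (Real.tendsto_log_atTop.comp tendsto_natCast_atTop_atTop).eventually_gt_atTop 2
  refine ⟨hinf, hsup, ?_, ?_⟩
  -- A limit would equal the liminf `0`, but infinitely often `H_n > (n log n) / 2 > n`.
  · rintro ⟨l, hl⟩
    rw [hl.liminf_eq] at hinf
    rw [hinf, ← EReal.coe_zero, EReal.tendsto_coe] at hl
    obtain ⟨n, hn, hn1, hn2, hn3⟩ := ((hhigh' (1 / 2) one_half_pos).and_eventually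
      ((hl.eventually_lt_const one_pos).and (hlog.and (eventually_ge_atTop 1)))).exists
    have hn' : (0 : ℝ) < n := by exact_mod_cast hn3
    rw [div_lt_one hn'] at hn1
    nlinarith
  -- A limit would equal the limsup `1`, forcing `H_n > (n log n) / 2 > n` eventually, whereas `H_n
  -- < n` infinitely often.
  · rintro ⟨l, hl⟩
    rw [hl.limsup_eq] at hsup
    rw [hsup, ← EReal.coe_one, EReal.tendsto_coe] at hl
    obtain ⟨n, hn, hn1, hn2, hn3⟩ := ((hlow' 1 one_pos).and_eventually
      ((hl.eventually_const_lt one_half_lt_one).and (hlog.and (eventually_ge_atTop 1)))).exists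
    have hn' : (0 : ℝ) < n := by exact_mod_cast hn3
    rw [lt_div_iff₀ (mul_pos hn' (by linarith))] at hn1
    nlinarith
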